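/- Let $A,B,C\in\mathbb{R}^{n\times n}$ satisfy the following assumptions. - A4: $A\ge 0$, $C\ge 0$ entrywise, and $B$ is an M-matrix, i.e. $B=sI-P$ with $P\ge 0$ entrywise, $s\ge 0$ and $s\ge\rho(P)$. - A5: $(A-B+C)\mathbf 1=\mathbf 0$. - A6: the bi-infinite block tridiagonal matrix with $A$, $-B$, $C$ on the block sub-, main and superdiagonal is irreducible and aperiodic (with respect to the directed graph of its nonzero entries). Cyclic Reduction is the iteration $A_0=A$, $B_0=\widehat B_0=B$, $C_0=C$, $$A_{k+1}=A_kB_k^{-1}A_k,\quad B_{k+1}=B_k-A_kB_k^{-1}C_k-C_kB_k^{-1}A_k,\quad C_{k+1}=C_kB_k^{-1}C_k,\quad \widehat B_{k+1}=\widehat B_k-C_kB_k^{-1}A_k .$$ Put $S_k=(A_k,-\mathrm{offdiag}(B_k),-\mathrm{offdiag}(\widehat B_k),C_k)$, where $\mathrm{offdiag}$ denotes the collection of off-diagonal entries. Consider floating-point arithmetic with unit roundoff $u$ in the standard model without overflow or underflow: the set of machine numbers is closed under negation, and floating-point addition, multiplication and division of machine numbers return machine numbers and have relative error at most $u$. Let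 $\widetilde S_k$ be the result of performing $k$ steps of Cyclic Reduction in this arithmetic, starting from $\widetilde S_0=S_0=(A,-\mathrm{offdiag}(B),-\mathrm{offdiag}(B),C)$. A step from $(A,-\mathrm{offdiag}(B),-\mathrm{offdiag}(\widehat B),C)$ computes, in floating point, 1. $w=(A+C)\mathbf 1$; 2. $X=B^{-1}A$ and $Y=B^{-1}C$, column by column, by the GTH algorithm on the triplet representation $(\mathrm{offdiag}(B),\mathbf 1,w)$, as described below; 3. the products $AX$, $CY$, $AY$, $CX$; 4. the new 4-tuple, consisting of $AX$, the off-diagonal entries of $(-B+AY)+CX$, those of $-\widehat B+CX$, and $CY$. Sums of several terms are evaluated from left to right. The GTH algorithm solves $Mx=b$, where $M\mathbf 1=w$ and $N_{ij}=-M_{ij}$ for $i\ne j$, by Gaussian elimination without subtractions. It computes the first pivot as $d=w_1+\sum_{j>1}N_{1j}$ and, with $l_i=N_{i1}/d$, replaces $N_{ij},w_i,b_i$ by $N_{ij}+l_iN_{1j}$, $w_i+l_iw_1$, $b_i+l_ib_1$ for $i,j>1$, $i\neq j$. It solves the remaining system recursively for $x_2,\dots,x_n$, and finally sets $x_1=(b_1+\sum_{j>1}N_{1j}x_j)/d$.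 Then for all $n$ and $k$ there is a threshold $u_0>0$, depending only on $n$ and $k$, such that the following holds whenever $0\le u\le u_0$, $A,B,C\in\mathbb{R}^{n\times n}$ satisfy A4, A5, A6, and the entries of $A$, $C$ and $\mathrm{offdiag}(B)$ are machine numbers. All the matrices $B_h$, $h\ge 0$, of the exact iteration are invertible, and $$|\widetilde S_k-S_k|\le n\,2^k\,(\psi(n)+n+2)\,u\,S_k,\qquad \psi(n)=\tfrac23(2n+5)(n+2)(n+3),$$ where the inequality holds componentwise in each of the four components of the tuples. -/

import Mathlib

namespace CyclicReduction

noncomputable section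

/-! ### Matrices and the standing assumptions -/

/-- `M` is an M-matrix: `M = s I - P` with `P ≥ 0` entrywise, `s ≥ 0` and `s ≥ ρ(P)`.
The spectral radius is the one over the complex numbers. -/
def IsMMatrix {n : ℕ} (M : Matrix (Fin n) (Fin n) ℝ) : Prop :=
  ∃ (s : ℝ) (P : Matrix (Fin n) (Fin n) ℝ), 0 ≤ s ∧ (∀ i j, 0 ≤ P i j) ∧
    spectralRadius ℂ (P.map (fun x : ℝ => (x : ℂ))) ≤ ENNReal.ofReal s ∧
    M = s • (1 : Matrix (Fin n) (Fin n) ℝ) - P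

/-- In the directed graph of the nonzero entries of `M` there is a walk with `m` edges from `i`
to `j`. The index set may be infinite. -/
def HasWalk {ι : Type*} (M : Matrix ι ι ℝ) : ℕ → ι → ι → Prop
  | 0, i, j => i = j
  | m + 1, i, j => ∃ l, M i l ≠ 0 ∧ HasWalk M m l j

/-- Irreducibility: the graph of the nonzero entries is strongly connected. -/
def IsIrreducible {ι : Type*} (M : Matrix ι ι ℝ) : Prop :=
  ∀ i j, ∃ m, HasWalk M m i j

/-- Aperiodicity: at every index, the lengths of the closed walks have greatest common
divisor `1`. -/
def IsAperiodic {ι : Type*} (M : Matrix ι ι ℝ) : Prop :=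
  ∀ (i : ι) (d : ℕ), (∀ m, 0 < m → HasWalk M m i i → d ∣ m) → d = 1

/-- The bi-infinite block tridiagonal matrix whose block row `l` has `A` in block column `l - 1`,
`-B` in block column `l` and `C` in block column `l + 1`. -/
def biInfinite {n : ℕ} (A B C : Matrix (Fin n) (Fin n) ℝ) :
    Matrix (ℤ × Fin n) (ℤ × Fin n) ℝ :=
  fun p q =>
    if q.1 = p.1 - 1 then A p.2 q.2
    else if q.1 = p.1 then -B p.2 q.2
    else if q.1 = p.1 + 1 then C p.2 q.2
    else 0

/-- The standing assumptions on the coefficients of the quadratic matrix equation. -/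
structure Admissible {n : ℕ} (A B C : Matrix (Fin n) (Fin n) ℝ) : Prop where
  /-- A4: `A ≥ 0`, `C ≥ 0` and `B` is an M-matrix. -/
  A_nonneg : ∀ i j, 0 ≤ A i j
  C_nonneg : ∀ i j, 0 ≤ C i j
  B_mMatrix : IsMMatrix B
  /-- A5: `(A - B + C) 1 = 0`. -/
  mulVec_one : (A - B + C).mulVec 1 = 0
  /-- A6: the bi-infinite matrix is irreducible and aperiodic. -/
  irreducible : IsIrreducible (biInfinite A B C)
  aperiodic : IsAperiodic (biInfinite A B C)

/-! ### Cyclic Reduction in exact arithmetic -/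

/-- The four matrices `A_k`, `B_k`, `B̂_k`, `C_k` carried by Cyclic Reduction. -/
structure Iterate (n : ℕ) where
  A : Matrix (Fin n) (Fin n) ℝ
  B : Matrix (Fin n) (Fin n) ℝ
  Bhat : Matrix (Fin n) (Fin n) ℝ
  C : Matrix (Fin n) (Fin n) ℝ

/-- One exact step of Cyclic Reduction. -/
def Iterate.step {n : ℕ} (T : Iterate n) : Iterate n where
  A := T.A * T.B⁻¹ * T.A
  B := T.B - T.A * T.B⁻¹ * T.C - T.C * T.B⁻¹ * T.A
  Bhat := T.Bhat - T.C * T.B⁻¹ * T.A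
  C := T.C * T.B⁻¹ * T.C

/-- The `k`-th exact iterate, started from `A_0 = A`, `B_0 = B̂_0 = B`, `C_0 = C`. -/
def exactIterate {n : ℕ} (A B C : Matrix (Fin n) (Fin n) ℝ) : ℕ → Iterate n
  | 0 => ⟨A, B, B, C⟩
  | k + 1 => (exactIterate A B C k).step

/-- `-offdiag(M)`, stored as a matrix with zero diagonal. -/
def negOffdiag {n : ℕ} (M : Matrix (Fin n) (Fin n) ℝ) : Matrix (Fin n) (Fin n) ℝ :=
  fun i j => if i = j then 0 else -M i j

/-- A 4-tuple `S = (A, -offdiag(B), -offdiag(B̂), C)`. The second and third components are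
stored as matrices with zero diagonal; their diagonals carry no information. -/
structure Tuple (n : ℕ) where
  A : Matrix (Fin n) (Fin n) ℝ
  negB : Matrix (Fin n) (Fin n) ℝ
  negBhat : Matrix (Fin n) (Fin n) ℝ
  C : Matrix (Fin n) (Fin n) ℝ

/-- The 4-tuple `(A_k, -offdiag(B_k), -offdiag(B̂_k), C_k)` of an iterate. -/
def Iterate.tuple {n : ℕ} (T : Iterate n) : Tuple n where
  A := T.A
  negB := negOffdiag T.B
  negBhat := negOffdiag T.Bhat
  C := T.C

/-- `|S' - S| ≤ α S`, componentwise in each of the four components. -/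
def RelErrorLE {n : ℕ} (S' S : Tuple n) (α : ℝ) : Prop :=
  (∀ i j, |S'.A i j - S.A i j| ≤ α * S.A i j) ∧
  (∀ i j, |S'.negB i j - S.negB i j| ≤ α * S.negB i j) ∧
  (∀ i j, |S'.negBhat i j - S.negBhat i j| ≤ α * S.negBhat i j) ∧
  (∀ i j, |S'.C i j - S.C i j| ≤ α * S.C i j)

/-! ### Floating-point arithmetic -/

/-- Floating-point arithmetic with unit roundoff `u`, in the standard model without overflow and
underflow: a set of machine numbers closed under negation, with floating-point addition,
multiplication and division that return machine numbers and commit a relative error of at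
most `u` on machine numbers. -/
structure FloatArith (u : ℝ) where
  carrier : Set ℝ
  add : ℝ → ℝ → ℝ
  mul : ℝ → ℝ → ℝ
  div : ℝ → ℝ → ℝ
  neg_mem : ∀ x ∈ carrier, -x ∈ carrier
  add_mem : ∀ x ∈ carrier, ∀ y ∈ carrier, add x y ∈ carrier
  mul_mem : ∀ x ∈ carrier, ∀ y ∈ carrier, mul x y ∈ carrier
  div_mem : ∀ x ∈ carrier, ∀ y ∈ carrier, y ≠ 0 → div x y ∈ carrier
  add_err : ∀ x ∈ carrier, ∀ y ∈ carrier, |add x y - (x + y)| ≤ u * |x + y|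
  mul_err : ∀ x ∈ carrier, ∀ y ∈ carrier, |mul x y - x * y| ≤ u * |x * y|
  div_err : ∀ x ∈ carrier, ∀ y ∈ carrier, y ≠ 0 → |div x y - x / y| ≤ u * |x / y|

namespace FloatArith

variable {u : ℝ} (F : FloatArith u)

/-- Floating-point sum `(⋯((x_0 + x_1) + x_2) + ⋯) + x_{n-1}`, with `n - 1` additions. -/
def sum : {n : ℕ} → (Fin n → ℝ) → ℝ
  | 0, _ => 0
  | 1, x => x 0
  | n + 2, x => F.add (sum fun i : Fin (n + 1) => x i.castSucc) (x (Fin.last (n + 1)))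

/-- Floating-point product of two matrices. -/
def matMul {n : ℕ} (X Y : Matrix (Fin n) (Fin n) ℝ) : Matrix (Fin n) (Fin n) ℝ :=
  fun i j => F.sum fun l => F.mul (X i l) (Y l j)

/-- The GTH algorithm in floating point: solves `M x = b` for the M-matrix `M` with triplet
representation `(offdiag(M), 1, w)`. Here `N` holds `-offdiag(M)` (its diagonal is never read), so
that `M i i = w i + ∑ j ≠ i, N i j`.

It is Gaussian elimination without subtractions: the pivot `d = M 0 0` is recovered from the
triplet, row and column `0` are eliminated (which gives the off-diagonal entries `N'` of the Schur
complement, its row sums `w'`, and the new right-hand side `b'`), the smaller system is solved by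
recursion, and the first unknown is obtained by back substitution. -/
def gthSolve : {n : ℕ} → Matrix (Fin n) (Fin n) ℝ → (Fin n → ℝ) → (Fin n → ℝ) → (Fin n → ℝ)
  | 0, _, _, b => b
  | n + 1, N, w, b =>
    let d : ℝ := F.sum (Fin.cons (w 0) fun j : Fin n => N 0 j.succ : Fin (n + 1) → ℝ)
    let l : Fin n → ℝ := fun i => F.div (N i.succ 0) d
    let N' : Matrix (Fin n) (Fin n) ℝ :=
      fun i j => F.add (N i.succ j.succ) (F.mul (l i) (N 0 j.succ))
    let w' : Fin n → ℝ := fun i => F.add (w i.succ) (F.mul (l i) (w 0))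
    let b' : Fin n → ℝ := fun i => F.add (b i.succ) (F.mul (l i) (b 0))
    let x : Fin n → ℝ := gthSolve N' w' b'
    Fin.cons
      (F.div (F.sum (Fin.cons (b 0) fun j : Fin n => F.mul (N 0 j.succ) (x j) :
        Fin (n + 1) → ℝ)) d) x

/-- Floating-point evaluation of `w = (A + C) 1`. -/
def rowSums {n : ℕ} (A C : Matrix (Fin n) (Fin n) ℝ) : Fin n → ℝ :=
  fun i => F.sum fun j => F.add (A i j) (C i j)

/-- Floating-point evaluation of `B⁻¹ Y`, column by column, by the GTH algorithm applied to the
triplet representation `(offdiag(B), 1, (A + C) 1)` of the matrix `B` of the tuple `S`. -/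
def solve {n : ℕ} (S : Tuple n) (Y : Matrix (Fin n) (Fin n) ℝ) : Matrix (Fin n) (Fin n) ℝ :=
  fun i j => F.gthSolve S.negB (F.rowSums S.A S.C) (fun l => Y l j) i

/-- One step of Cyclic Reduction in floating-point arithmetic. -/
def step {n : ℕ} (S : Tuple n) : Tuple n :=
  let XA := F.solve S S.A
  let XC := F.solve S S.C
  { A := F.matMul S.A XA
    negB := fun i j => if i = j then 0 else
      F.add (F.add (S.negB i j) (F.matMul S.A XC i j)) (F.matMul S.C XA i j)
    negBhat := fun i j => if i = j then 0 else
      F.add (S.negBhat i j) (F.matMul S.C XA i j)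
    C := F.matMul S.C XC }

/-- The result of `k` floating-point steps of Cyclic Reduction, started from the 4-tuple
`(A, -offdiag(B), -offdiag(B), C)`. -/
def iterate {n : ℕ} (A B C : Matrix (Fin n) (Fin n) ℝ) : ℕ → Tuple n
  | 0 => ⟨A, negOffdiag B, negOffdiag B, C⟩
  | k + 1 => F.step (iterate A B C k)

end FloatArith

/-- `ψ(n) = (2/3) (2n + 5) (n + 2) (n + 3)`. -/
def psi (n : ℕ) : ℝ := 2 / 3 * (2 * n + 5) * (n + 2) * (n + 3)

end

end CyclicReduction

/-! No step of the algorithm subtracts: on nonnegative data there are only sums, products and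
quotients. Errors are therefore tracked multiplicatively: `Near ρ k` allows a factor between `ρ ^
(-k)` and `ρ ^ k`, where `ρ = growth u` accounts for one rounding and exponents add up.

The basic estimate is `IsSol.near`: if the off-diagonal entries, row sums and right-hand side of a
diagonally dominant system change by factors with exponent `a` in `r` rows, the nonnegative solution
changes by factors with exponent at most `2 * a * r`, independently of conditioning. Applied to each
reduced system in Gaussian elimination, it gives the GTH bound `gthSolve_near` and then the bound
`step_near` for one floating-point step.

Propagating an early error through later steps one step at a time would multiply its exponent by `1
+ 2n` at each step. Instead, `m` steps of Cyclic Reduction are read as the elimination of the levels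
strictly between `0` and `2 ^ m` of the bi-infinite system. The resulting matrices are obtained from
the solution of one Dirichlet problem with `(2 ^ m - 1) * n` interior unknowns (`exists_dirichlet`),
so a single use of `IsSol.near` bounds the propagation by a factor of order `n * 2 ^ m`
(`iterate_cr_near`). Adding the propagated local errors gives the exponent `2 * n * stepExp n * (2 ^
k - 1)` in `iterate_step_near`. It is strictly smaller than the claimed constant, and the gap
absorbs the terms of higher order in `u`.

Solvability throughout rests on a property of zero patterns: no nonempty finite set of nodes of the
bi-infinite graph is without exit. It follows from irreducibility, is inherited by Cyclic Reduction
through a maximum principle (`cr_noFiniteTrap`), and survives relative perturbations. -/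

namespace CyclicReduction

/-! ### Multiplicative closeness -/

/-- `a` and `b` agree up to a factor between `ρ ^ (-k)` and `ρ ^ k`. -/
def Near (ρ : ℝ) (k : ℕ) (a b : ℝ) : Prop := a ≤ ρ ^ k * b ∧ b ≤ ρ ^ k * a

namespace Near

variable {ρ a b c d : ℝ} {k l : ℕ}

theorem refl (hρ : 1 ≤ ρ) (k : ℕ) (ha : 0 ≤ a) : Near ρ k a a :=
  have : a ≤ ρ ^ k * a := le_mul_of_one_le_left ha (one_le_pow₀ hρ)
  ⟨this, this⟩

theorem trans (hρ : 1 ≤ ρ) (h : Near ρ k a b) (h' : Near ρ l b c) : Near ρ (k + l) a c := by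
  have hk : 0 ≤ ρ ^ k := by positivity
  have hl : 0 ≤ ρ ^ l := by positivity
  rw [Near, pow_add]
  exact ⟨h.1.trans (by nlinarith [mul_le_mul_of_nonneg_left h'.1 hk]),
    h'.2.trans (by nlinarith [mul_le_mul_of_nonneg_left h.2 hl])⟩

theorem mono (hρ : 1 ≤ ρ) (ha : 0 ≤ a) (hb : 0 ≤ b) (hkl : k ≤ l) (h : Near ρ k a b) :
    Near ρ l a b := by
  have := pow_le_pow_right₀ hρ hkl
  exact ⟨h.1.trans (mul_le_mul_of_nonneg_right this hb),
    h.2.trans (mul_le_mul_of_nonneg_right this ha)⟩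

theorem nonneg (hρ : 1 ≤ ρ) (hb : 0 ≤ b) (h : Near ρ k a b) : 0 ≤ a := by
  have hk : 0 < ρ ^ k := by positivity
  exact nonneg_of_mul_nonneg_right (hb.trans h.2) hk

theorem pos (hρ : 1 ≤ ρ) (hb : 0 < b) (h : Near ρ k a b) : 0 < a := by
  have hk : 0 < ρ ^ k := by positivity
  exact (mul_pos_iff_of_pos_left hk).1 (hb.trans_le h.2)

theorem ne_zero (hb : 0 ≤ b) (h : Near ρ k a b) (hb' : b ≠ 0) : a ≠ 0 := by
  rintro rfl
  have := h.2
  simp only [mul_zero] at this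
  exact hb' (le_antisymm this hb)

theorem add (h : Near ρ k a b) (h' : Near ρ k c d) : Near ρ k (a + c) (b + d) := by
  rw [Near, mul_add, mul_add]
  exact ⟨add_le_add h.1 h'.1, add_le_add h.2 h'.2⟩

theorem sum {ι : Type*} {s : Finset ι} {f g : ι → ℝ} (h : ∀ i ∈ s, Near ρ k (f i) (g i)) :
    Near ρ k (∑ i ∈ s, f i) (∑ i ∈ s, g i) := by
  rw [Near, Finset.mul_sum, Finset.mul_sum]
  exact ⟨Finset.sum_le_sum fun i hi => (h i hi).1, Finset.sum_le_sum fun i hi => (h i hi).2⟩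

theorem mul (hρ : 1 ≤ ρ) (hb : 0 ≤ b) (hd : 0 ≤ d) (h : Near ρ k a b) (h' : Near ρ l c d) :
    Near ρ (k + l) (a * c) (b * d) := by
  have ha := h.nonneg hρ hb
  have hc := h'.nonneg hρ hd
  rw [Near, pow_add]
  constructor
  · calc a * c ≤ (ρ ^ k * b) * (ρ ^ l * d) := mul_le_mul h.1 h'.1 hc (by positivity)
      _ = _ := by ring
  · calc b * d ≤ (ρ ^ k * a) * (ρ ^ l * c) := mul_le_mul h.2 h'.2 hd (by positivity)
      _ = _ := by ring

theorem inv (hρ : 1 ≤ ρ) (hb : 0 < b) (h : Near ρ k a b) : Near ρ k a⁻¹ b⁻¹ := by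
  have ha := h.pos hρ hb
  constructor
  · rw [inv_le_iff_one_le_mul₀ ha, mul_right_comm, ← div_eq_mul_inv, one_le_div hb]
    exact h.2
  · rw [inv_le_iff_one_le_mul₀ hb, mul_right_comm, ← div_eq_mul_inv, one_le_div ha]
    exact h.1

theorem div (hρ : 1 ≤ ρ) (hb : 0 ≤ b) (hd : 0 < d) (h : Near ρ k a b) (h' : Near ρ l c d) :
    Near ρ (k + l) (a / c) (b / d) := by
  rw [div_eq_mul_inv, div_eq_mul_inv]
  exact h.mul hρ hb (by positivity) (h'.inv hρ hd)

end Near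

/-! ### Diagonally dominant systems in triplet form -/

section System

variable {ι : Type*}

/-- Every nonempty set of indices has a row with positive row sum or an edge leaving the set. -/
def NoTrap (N : ι → ι → ℝ) (w : ι → ℝ) : Prop :=
  ∀ J : Set ι, J.Nonempty → ∃ i ∈ J, w i ≠ 0 ∨ ∃ j, j ∉ J ∧ N i j ≠ 0

variable {N N' : ι → ι → ℝ} {w w' b b' x x' : ι → ℝ}

/-- Only the zero pattern matters, so solvability passes to every entrywise relative perturbation.
-/
theorem NoTrap.of_ne_zero (hT : NoTrap N w) (hN : ∀ i j, i ≠ j → N i j ≠ 0 → N' i j ≠ 0)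
    (hw : ∀ i, w i ≠ 0 → w' i ≠ 0) : NoTrap N' w' := by
  intro J hJ
  obtain ⟨i, hi, h⟩ := hT J hJ
  refine ⟨i, hi, h.imp (hw i) ?_⟩
  rintro ⟨j, hj, h⟩
  exact ⟨j, hj, hN i j (fun e => hj (e ▸ hi)) h⟩

variable [Fintype ι]

/-- Left-hand side of the system with off-diagonal part `-N` and row sums `w`. -/
def tripletApply (N : ι → ι → ℝ) (w x : ι → ℝ) (i : ι) : ℝ :=
  w i * x i + ∑ j, N i j * (x i - x j)

/-- `x` solves the system with off-diagonal part `-N`, row sums `w` and right-hand side `b`. -/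
def IsSol (N : ι → ι → ℝ) (w b x : ι → ℝ) : Prop := ∀ i, tripletApply N w x i = b i

theorem tripletApply_add (x y : ι → ℝ) (i : ι) :
    tripletApply N w (x + y) i = tripletApply N w x i + tripletApply N w y i := by
  simp only [tripletApply, Pi.add_apply]
  rw [add_add_add_comm, ← Finset.sum_add_distrib, mul_add]
  congr 1
  exact Finset.sum_congr rfl fun j _ => by ring

theorem tripletApply_smul (c : ℝ) (x : ι → ℝ) (i : ι) :
    tripletApply N w (c • x) i = c * tripletApply N w x i := by
  simp only [tripletApply, Pi.smul_apply, smul_eq_mul]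
  rw [mul_add, Finset.mul_sum]
  congr 1
  · ring
  · exact Finset.sum_congr rfl fun j _ => by ring

theorem tripletApply_sub (x y : ι → ℝ) (i : ι) :
    tripletApply N w (x - y) i = tripletApply N w x i - tripletApply N w y i := by
  rw [sub_eq_add_neg, ← neg_one_smul ℝ y, tripletApply_add, tripletApply_smul]
  ring

/-- Minimum principle. -/
theorem NoTrap.nonneg_of (hT : NoTrap N w) (hN : ∀ i j, i ≠ j → 0 ≤ N i j) (hw : ∀ i, 0 ≤ w i)
    (hx : ∀ i, x i < 0 → 0 ≤ tripletApply N w x i) (i : ι) : 0 ≤ x i := by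
  by_contra! hi
  have : Nonempty ι := ⟨i⟩
  obtain ⟨m, hm⟩ := Finite.exists_min x
  have hneg : x m < 0 := (hm i).trans_lt hi
  -- The set where the minimum is attained is not a trap. At the row `p` so obtained every term of
  -- the left-hand side is nonpositive and one is strictly negative.
  obtain ⟨p, hp, h⟩ := hT {i | x i = x m} ⟨m, rfl⟩
  have hp' : x p = x m := hp
  have h0 := hx p (hp' ▸ hneg)
  have hterm : ∀ j, N p j * (x p - x j) ≤ 0 := by
    intro j
    by_cases e : p = j
    · simp [e]
    · exact mul_nonpos_of_nonneg_of_nonpos (hN p j e) (by rw [hp']; linarith [hm j])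
  have hwx : w p * x p ≤ 0 := mul_nonpos_of_nonneg_of_nonpos (hw p) (hp' ▸ hneg.le)
  have hsum : ∑ j, N p j * (x p - x j) ≤ 0 := Finset.sum_nonpos fun j _ => hterm j
  rw [tripletApply] at h0
  rcases h with h | ⟨j, hj, h⟩
  · have : w p * x p < 0 := mul_neg_of_pos_of_neg ((hw p).lt_of_ne' h) (hp' ▸ hneg)
    linarith
  · have e : p ≠ j := fun e => hj (e ▸ hp)
    have hlt : x m < x j := (hm j).lt_of_ne' hj
    have : ∑ j, N p j * (x p - x j) < 0 :=
      Finset.sum_neg' (fun j _ => hterm j) ⟨j, Finset.mem_univ j,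
        mul_neg_of_pos_of_neg ((hN p j e).lt_of_ne' h) (by rw [hp']; linarith)⟩
    linarith

theorem NoTrap.nonneg (hT : NoTrap N w) (hN : ∀ i j, i ≠ j → 0 ≤ N i j) (hw : ∀ i, 0 ≤ w i)
    (hb : ∀ i, 0 ≤ b i) (hx : IsSol N w b x) (i : ι) : 0 ≤ x i :=
  hT.nonneg_of hN hw (fun i _ => (hb i).trans_eq (hx i).symm) i

/-- The equation is needed only where `x` does not vanish, so a row at which `x` is known to be zero
can be ignored. -/
theorem NoTrap.eq_zero (hT : NoTrap N w) (hN : ∀ i j, i ≠ j → 0 ≤ N i j) (hw : ∀ i, 0 ≤ w i)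
    (hx : ∀ i, x i ≠ 0 → tripletApply N w x i = 0) : x = 0 := by
  ext i
  refine le_antisymm ?_ (hT.nonneg_of hN hw (fun i hi => (hx i hi.ne).ge) i)
  have := hT.nonneg_of (x := (-1 : ℝ) • x) hN hw (fun i hi => by
    rw [tripletApply_smul, hx i (by rintro h; simp [h] at hi), mul_zero]) i
  simp only [Pi.smul_apply, smul_eq_mul] at this
  simp only [Pi.zero_apply]
  linarith

theorem NoTrap.isSol_unique (hT : NoTrap N w) (hN : ∀ i j, i ≠ j → 0 ≤ N i j)
    (hw : ∀ i, 0 ≤ w i) (hx : IsSol N w b x) (hx' : IsSol N w b x') : x = x' := by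
  refine sub_eq_zero.1 (hT.eq_zero hN hw fun i _ => ?_)
  rw [tripletApply_sub, hx i, hx' i, sub_self]

theorem NoTrap.exists_isSol (hT : NoTrap N w) (hN : ∀ i j, i ≠ j → 0 ≤ N i j)
    (hw : ∀ i, 0 ≤ w i) (b : ι → ℝ) : ∃ x, IsSol N w b x := by
  let T : (ι → ℝ) →ₗ[ℝ] (ι → ℝ) :=
    { toFun := tripletApply N w
      map_add' := fun x y => funext (tripletApply_add x y)
      map_smul' := fun c x => funext (tripletApply_smul c x) }
  have hinj : Function.Injective T := by
    rw [← LinearMap.ker_eq_bot, LinearMap.ker_eq_bot']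
    exact fun x hx => hT.eq_zero hN hw fun i _ => congrFun hx i
  obtain ⟨x, hx⟩ := LinearMap.surjective_of_injective hinj b
  exact ⟨x, congrFun hx⟩

/-- Changing one row of the data entrywise by factors between `ρ ^ (-a)` and `ρ ^ a` changes the
solution entrywise by factors between `ρ ^ (-2a)` and `ρ ^ (2a)`. -/
theorem IsSol.near_of_row {ρ : ℝ} {a : ℕ} (hρ : 1 ≤ ρ) (hT : NoTrap N w)
    (hN : ∀ i j, i ≠ j → 0 ≤ N i j) (hw : ∀ i, 0 ≤ w i) (hb : ∀ i, 0 ≤ b i)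
    (p : ι) (hrow : ∀ i, i ≠ p → N' i = N i ∧ w' i = w i ∧ b' i = b i)
    (hNp : ∀ j, p ≠ j → Near ρ a (N' p j) (N p j)) (hwp : Near ρ a (w' p) (w p))
    (hbp : Near ρ a (b' p) (b p)) (hx : IsSol N w b x) (hx' : IsSol N' w' b' x') (i : ι) :
    Near ρ (2 * a) (x' i) (x i) := by
  classical
  -- `v` is column `p` of the inverse. By the minimum principle it is nonnegative and largest at
  -- `p`.
  obtain ⟨v, hv⟩ := hT.exists_isSol hN hw (Pi.single p 1)
  have hvnp : ∀ i, i ≠ p → tripletApply N w v i = 0 := fun i hi => by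
    rw [hv i, Pi.single_eq_of_ne hi]
  have hvp : tripletApply N w v p = 1 := by rw [hv p, Pi.single_eq_same]
  have hv0 : ∀ i, 0 ≤ v i := hT.nonneg hN hw (fun i => by
    by_cases h : i = p <;> simp [h]) hv
  have hx0 := hT.nonneg hN hw hb hx
  have hvle : ∀ i, 0 ≤ v p - v i := hT.nonneg_of (x := fun i => v p - v i) hN hw (fun i hi => by
    have hip : i ≠ p := by rintro rfl; simp at hi
    have h1 := hvnp i hip
    have : tripletApply N w (fun i => v p - v i) i = w i * v p - tripletApply N w v i := by
      simp only [tripletApply]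
      have : ∑ j, N i j * (v p - v i - (v p - v j)) = - ∑ j, N i j * (v i - v j) := by
        rw [← Finset.sum_neg_distrib]
        exact Finset.sum_congr rfl fun j _ => by ring
      rw [this]; ring
    rw [this, h1, sub_zero]
    exact mul_nonneg (hw i) (hv0 p))
  have hvpos : 0 < v p := by
    refine (hv0 p).lt_of_ne' fun h => ?_
    have hz : ∀ i, v i = 0 := fun i => le_antisymm (by linarith [hvle i]) (hv0 i)
    rw [tripletApply] at hvp
    simp [hz] at hvp
  have happ : ∀ i, i ≠ p → tripletApply N w x' i = b i := fun i hi => by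
    have := hx' i
    rw [tripletApply, (hrow i hi).1, (hrow i hi).2.1, (hrow i hi).2.2] at this
    exact this
  -- `g` vanishes at `p` and solves the equations of the other rows with right-hand side `v p • b`.
  -- These conditions determine it without row `p`, so the perturbed solution yields the same `g`.
  -- Only the scalar `x p` feels the perturbation.
  set g : ι → ℝ := v p • x - x p • v with hg
  have hg0 : ∀ i, 0 ≤ g i := hT.nonneg_of hN hw fun i hi => by
    have hip : i ≠ p := by
      rintro rfl
      simp [hg, mul_comm] at hi
    rw [hg, tripletApply_sub, tripletApply_smul, tripletApply_smul, hx i, hvnp i hip]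
    have := mul_nonneg hvpos.le (hb i)
    linarith
  have hgg : v p • x' - x' p • v = g := by
    refine sub_eq_zero.1 (hT.eq_zero hN hw fun i hi => ?_)
    have hip : i ≠ p := by
      rintro rfl
      apply hi
      simp [hg, mul_comm]
    rw [hg, tripletApply_sub, tripletApply_sub, tripletApply_sub, tripletApply_smul,
      tripletApply_smul, tripletApply_smul, tripletApply_smul, hx i, hvnp i hip, happ i hip]
    ring
  have e : ∀ i, v p * x i = g i + x p * v i := fun i => by simp [hg]
  have e' : ∀ i, v p * x' i = g i + x' p * v i := fun i => by rw [← hgg]; simp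
  have hgp : g p = 0 := by have := e p; linarith
  -- This expresses `y p` as a quotient whose numerator and denominator are linear in the data of
  -- row `p`, with the nonnegative coefficients `v p`, `g j` and `v p`, `v p - v j`. Each changes by
  -- exponent `a`, hence the quotient by `2 * a`.
  have key : ∀ (M : ι → ι → ℝ) (z c y : ι → ℝ), tripletApply M z y p = c p →
      (∀ i, v p * y i = g i + y p * v i) →
      y p * tripletApply M z v p = c p * v p + ∑ j, M p j * g j := by
    intro M z c y hy hgy
    rw [← hy, tripletApply, tripletApply, mul_add, add_mul, add_assoc, Finset.mul_sum,
      Finset.sum_mul, ← Finset.sum_add_distrib]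
    congr 1
    · ring
    · refine Finset.sum_congr rfl fun j _ => ?_
      linear_combination (M p j) * hgy j
  have hQ := key N w b x (hx p) e
  have hQ' := key N' w' b' x' (hx' p) e'
  have nD : Near ρ a (tripletApply N' w' v p) (tripletApply N w v p) := by
    refine Near.add ?_ (Near.sum fun j _ => ?_)
    · exact (hwp.mul hρ (hw p) (hv0 p) (Near.refl hρ 0 (hv0 p)))
    · by_cases h : p = j
      · subst h; simp [Near]
      · exact ((hNp j h).mul hρ (hN p j h) (hvle j) (Near.refl hρ 0 (hvle j)))
  have nQ : Near ρ a (b' p * v p + ∑ j, N' p j * g j) (b p * v p + ∑ j, N p j * g j) := by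
    refine Near.add ?_ (Near.sum fun j _ => ?_)
    · exact (hbp.mul hρ (hb p) (hv0 p) (Near.refl hρ 0 (hv0 p)))
    · by_cases h : p = j
      · subst h; simp [Near, hgp]
      · exact ((hNp j h).mul hρ (hN p j h) (hg0 j) (Near.refl hρ 0 (hg0 j)))
  rw [hvp] at nD
  rw [hvp, mul_one] at hQ
  have hD' : 0 < tripletApply N' w' v p := nD.pos hρ one_pos
  have nxp : Near ρ (2 * a) (x' p) (x p) := by
    have := nQ.div hρ (hQ ▸ hx0 p) one_pos nD
    rw [← hQ, ← hQ', div_one, mul_div_assoc, div_self hD'.ne', mul_one, ← two_mul] at this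
    exact this
  have nv : Near ρ (2 * a) (v p * x' i) (v p * x i) := by
    rw [e, e']
    exact (Near.refl hρ _ (hg0 i)).add (nxp.mul hρ (hx0 p) (hv0 i) (Near.refl hρ 0 (hv0 i)))
  rw [Near, mul_left_comm, mul_left_comm (ρ ^ _), mul_le_mul_iff_right₀ hvpos,
    mul_le_mul_iff_right₀ hvpos] at nv
  exact nv

/-- Changing the rows in `s` of the data entrywise by factors between `ρ ^ (-a)` and `ρ ^ a`
changes the solution entrywise by factors between `ρ ^ (-2a|s|)` and `ρ ^ (2a|s|)`. -/
theorem IsSol.near {ρ : ℝ} {a : ℕ} (hρ : 1 ≤ ρ) (hT : NoTrap N w)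
    (hN : ∀ i j, i ≠ j → 0 ≤ N i j) (hw : ∀ i, 0 ≤ w i) (hb : ∀ i, 0 ≤ b i) (s : Finset ι)
    (hrow : ∀ i, i ∉ s → N' i = N i ∧ w' i = w i ∧ b' i = b i)
    (hNs : ∀ i j, i ≠ j → Near ρ a (N' i j) (N i j)) (hws : ∀ i, Near ρ a (w' i) (w i))
    (hbs : ∀ i, Near ρ a (b' i) (b i)) (hx : IsSol N w b x) (hx' : IsSol N' w' b' x') (i : ι) :
    Near ρ (2 * a * s.card) (x' i) (x i) := by
  classical
  have trap : ∀ {M : ι → ι → ℝ} {z : ι → ℝ}, (∀ i j, i ≠ j → Near ρ a (M i j) (N i j)) →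
      (∀ i, Near ρ a (z i) (w i)) → NoTrap M z := fun hM hz =>
    hT.of_ne_zero (fun i j h => (hM i j h).ne_zero (hN i j h)) fun i => (hz i).ne_zero (hw i)
  induction s using Finset.induction_on generalizing N' w' b' x' i with
  | empty =>
    have h1 : N' = N := funext fun i => (hrow i (by simp)).1
    have h2 : w' = w := funext fun i => (hrow i (by simp)).2.1
    have h3 : b' = b := funext fun i => (hrow i (by simp)).2.2
    subst h1 h2 h3
    rw [hT.isSol_unique hN hw hx' hx]
    exact Near.refl hρ _ (hT.nonneg hN hw hb hx i)
  | insert p s hp ih =>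
    -- The intermediate system has row `p` restored to its unperturbed data. It differs from the
    -- original one only in the rows of `s`, and from the fully perturbed one only in row `p`.
    have hMs : ∀ i j, i ≠ j → Near ρ a ((Function.update N' p (N p)) i j) (N i j) := by
      intro i j h
      by_cases e : i = p
      · subst e; rw [Function.update_self]; exact Near.refl hρ _ (hN _ _ h)
      · rw [Function.update_of_ne e]; exact hNs i j h
    have hzs : ∀ i, Near ρ a ((Function.update w' p (w p)) i) (w i) := by
      intro i
      by_cases e : i = p
      · subst e; rw [Function.update_self]; exact Near.refl hρ _ (hw _)
      · rw [Function.update_of_ne e]; exact hws i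
    have hcs : ∀ i, Near ρ a ((Function.update b' p (b p)) i) (b i) := by
      intro i
      by_cases e : i = p
      · subst e; rw [Function.update_self]; exact Near.refl hρ _ (hb _)
      · rw [Function.update_of_ne e]; exact hbs i
    have hT1 := trap hMs hzs
    have hN1 := fun i j h => (hMs i j h).nonneg hρ (hN i j h)
    have hw1 := fun i => (hzs i).nonneg hρ (hw i)
    have hb1 := fun i => (hcs i).nonneg hρ (hb i)
    obtain ⟨y, hy⟩ := hT1.exists_isSol hN1 hw1 (Function.update b' p (b p))
    have h1 : Near ρ (2 * a * s.card) (y i) (x i) := by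
      refine ih (fun i hi => ?_) hMs hzs hcs hy i
      by_cases e : i = p
      · subst e; simp
      · simp only [Function.update_of_ne e]
        exact hrow i (by simp [e, hi])
    have h2 : Near ρ (2 * a) (x' i) (y i) := by
      refine hy.near_of_row hρ hT1 hN1 hw1 hb1 p (fun i e => ?_) ?_ ?_ ?_ hx' i
      · simp only [Function.update_of_ne e, and_self]
      · intro j h; rw [Function.update_self]; exact hNs p j h
      · rw [Function.update_self]; exact hws p
      · rw [Function.update_self]; exact hbs p
    rw [Finset.card_insert_of_notMem hp, mul_add_one, add_comm]
    exact h2.trans hρ h1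

end System

/-! ### Elimination of one unknown -/

section Elimination

variable {n : ℕ} {N : Fin (n + 1) → Fin (n + 1) → ℝ} {w b x : Fin (n + 1) → ℝ}

/-- The pivot of the first unknown. -/
noncomputable def pivot (N : Fin (n + 1) → Fin (n + 1) → ℝ) (w : Fin (n + 1) → ℝ) : ℝ :=
  w 0 + ∑ j : Fin n, N 0 j.succ

/-- Off-diagonal part of the system after elimination of the first unknown. -/
noncomputable def elimMatrix (N : Fin (n + 1) → Fin (n + 1) → ℝ) (w : Fin (n + 1) → ℝ)
    (i j : Fin n) : ℝ :=
  N i.succ j.succ + N i.succ 0 / pivot N w * N 0 j.succ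

/-- Elimination of the first entry of a row-sum or right-hand side vector `b`. -/
noncomputable def elimVector (N : Fin (n + 1) → Fin (n + 1) → ℝ) (w b : Fin (n + 1) → ℝ)
    (i : Fin n) : ℝ :=
  b i.succ + N i.succ 0 / pivot N w * b 0

theorem NoTrap.pivot_pos (hT : NoTrap N w) (hN : ∀ i j, i ≠ j → 0 ≤ N i j) (hw : ∀ i, 0 ≤ w i) :
    0 < pivot N w := by
  have h0 : ∀ j : Fin n, 0 ≤ N 0 j.succ := fun j => hN _ _ (Fin.succ_ne_zero j).symm
  obtain ⟨i, rfl, h | ⟨j, hj, h⟩⟩ := hT {0} ⟨0, rfl⟩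
  · exact add_pos_of_pos_of_nonneg ((hw _).lt_of_ne' h) (Finset.sum_nonneg fun j _ => h0 j)
  · obtain ⟨j, rfl⟩ := Fin.exists_succ_eq.2 hj
    exact add_pos_of_nonneg_of_pos (hw _)
      (Finset.sum_pos' (fun j _ => h0 j) ⟨j, Finset.mem_univ _, (h0 j).lt_of_ne' h⟩)

theorem IsSol.row_zero (hx : IsSol N w b x) :
    pivot N w * x 0 = b 0 + ∑ j : Fin n, N 0 j.succ * x j.succ := by
  have := hx 0
  rw [tripletApply, Fin.sum_univ_succ] at this
  simp only [sub_self, mul_zero, zero_add, mul_sub, Finset.sum_sub_distrib,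
    ← Finset.sum_mul] at this
  rw [pivot]
  linarith

/-- The row sums are eliminated like a right-hand side because they are the image of the all-ones
vector. -/
theorem IsSol.tail (hd : pivot N w ≠ 0) (hx : IsSol N w b x) :
    IsSol (elimMatrix N w) (elimVector N w w) (elimVector N w b) fun i => x i.succ := by
  intro i
  have h0 := hx.row_zero
  have hi := hx i.succ
  rw [tripletApply, Fin.sum_univ_succ] at hi
  have hl : N i.succ 0 / pivot N w * pivot N w = N i.succ 0 := div_mul_cancel₀ _ hd
  have hp : pivot N w = w 0 + ∑ j : Fin n, N 0 j.succ := rfl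
  simp only [tripletApply, elimMatrix, elimVector, add_mul, Finset.sum_add_distrib]
  generalize N i.succ 0 / pivot N w = l at *
  have : ∑ j : Fin n, l * N 0 j.succ * (x i.succ - x j.succ) =
      l * ((∑ j : Fin n, N 0 j.succ) * x i.succ) - l * ∑ j : Fin n, N 0 j.succ * x j.succ := by
    rw [Finset.sum_mul, Finset.mul_sum, Finset.mul_sum, ← Finset.sum_sub_distrib]
    exact Finset.sum_congr rfl fun j _ => by ring
  rw [this]
  linear_combination hi + l * h0 + (x i.succ - x 0) * hl - l * x i.succ * hp

theorem elimMatrix_nonneg (hN : ∀ i j, i ≠ j → 0 ≤ N i j) (hd : 0 < pivot N w) (i j : Fin n)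
    (hij : i ≠ j) : 0 ≤ elimMatrix N w i j :=
  add_nonneg (hN _ _ (by simpa using hij)) (mul_nonneg
    (div_nonneg (hN _ _ (Fin.succ_ne_zero i)) hd.le) (hN _ _ (Fin.succ_ne_zero j).symm))

theorem elimVector_nonneg (hN : ∀ i j, i ≠ j → 0 ≤ N i j) (hd : 0 < pivot N w)
    (hb : ∀ i, 0 ≤ b i) (i : Fin n) : 0 ≤ elimVector N w b i :=
  add_nonneg (hb _) (mul_nonneg (div_nonneg (hN _ _ (Fin.succ_ne_zero i)) hd.le) (hb _))

/-- A trap `J` of the reduced system lifts to a trap of the full one: `J` together with the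
eliminated index if some row of `J` has an edge to it, and `J` alone otherwise. No cancellation can
hide an edge, as all terms are nonnegative. -/
theorem NoTrap.elim (hT : NoTrap N w) (hN : ∀ i j, i ≠ j → 0 ≤ N i j) (hw : ∀ i, 0 ≤ w i) :
    NoTrap (elimMatrix N w) (elimVector N w w) := by
  have hd := hT.pivot_pos hN hw
  intro J hJ
  by_contra! hcl
  have hl : ∀ i : Fin n, 0 ≤ N i.succ 0 / pivot N w := fun i =>
    div_nonneg (hN _ _ (Fin.succ_ne_zero i)) hd.le
  have h0 : ∀ j : Fin n, 0 ≤ N 0 j.succ := fun j => hN _ _ (Fin.succ_ne_zero j).symm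
  have hwJ : ∀ i ∈ J, w i.succ = 0 ∧ N i.succ 0 / pivot N w * w 0 = 0 := fun i hi =>
    (add_eq_zero_iff_of_nonneg (hw _) (mul_nonneg (hl i) (hw 0))).1 (hcl i hi).1
  have hNJ : ∀ i ∈ J, ∀ j, j ∉ J →
      N i.succ j.succ = 0 ∧ N i.succ 0 / pivot N w * N 0 j.succ = 0 := fun i hi j hj =>
    (add_eq_zero_iff_of_nonneg
      (hN _ _ (fun e => hj (by rwa [← Fin.succ_injective _ e]))) (mul_nonneg (hl i) (h0 j))).1
      ((hcl i hi).2 j hj)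
  by_cases hreach : ∃ i ∈ J, N i.succ 0 ≠ 0
  · obtain ⟨q, hq, hq0⟩ := hreach
    have hlq : N q.succ 0 / pivot N w ≠ 0 := div_ne_zero hq0 hd.ne'
    -- This set is the image of `J` under `Fin.succ` together with `0`.
    obtain ⟨i, hi, h⟩ := hT {i | ∀ j : Fin n, i = j.succ → j ∈ J} ⟨0, fun j h =>
      absurd h (Fin.succ_ne_zero j).symm⟩
    refine Fin.cases (motive := fun i => i ∈ {i : Fin (n + 1) | ∀ j : Fin n, i = j.succ → j ∈ J} →
      (w i ≠ 0 ∨ ∃ j, j ∉ {i : Fin (n + 1) | ∀ j : Fin n, i = j.succ → j ∈ J} ∧ N i j ≠ 0) →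
        False) ?_ ?_ i hi h
    · rintro - (h | ⟨j, hj, h⟩)
      · exact h ((mul_eq_zero.1 (hwJ q hq).2).resolve_left hlq)
      · simp only [Set.mem_ofPred_eq, not_forall] at hj
        obtain ⟨j, rfl, hj⟩ := hj
        exact h ((mul_eq_zero.1 (hNJ q hq j hj).2).resolve_left hlq)
    · rintro i hi (h | ⟨j, hj, h⟩)
      · exact h (hwJ i (hi i rfl)).1
      · simp only [Set.mem_ofPred_eq, not_forall] at hj
        obtain ⟨j, rfl, hj⟩ := hj
        exact h (hNJ i (hi i rfl) j hj).1
  · push Not at hreach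
    obtain ⟨_, ⟨i, hi, rfl⟩, h | ⟨j, hj, h⟩⟩ := hT (Fin.succ '' J) (hJ.image _)
    · exact h (hwJ i hi).1
    · refine Fin.cases (motive := fun j => j ∉ Fin.succ '' J → N i.succ j ≠ 0 → False)
        ?_ ?_ j hj h
      · exact fun _ h => h (hreach i hi)
      · exact fun j hj h => h (hNJ i hi j fun hj' => hj ⟨j, hj', rfl⟩).1

end Elimination

/-! ### Floating-point sums, products and GTH -/

/-- Growth factor `1 / (1 - u)` of a single rounding. -/
noncomputable def growth (u : ℝ) : ℝ := (1 - u)⁻¹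

theorem one_le_growth {u : ℝ} (hu : 0 ≤ u) (hu1 : u < 1) : 1 ≤ growth u :=
  (one_le_inv₀ (by linarith)).2 (by linarith)

/-- Exponent of the growth factor in the error bound of the GTH algorithm. -/
def gthExp : ℕ → ℕ
  | 0 => 0
  | n + 1 => gthExp n + 2 * n * (n + 3) + (2 * n + 2)

namespace FloatArith

variable {u : ℝ} (F : FloatArith u) (hu : 0 ≤ u) (hu1 : u < 1)

include hu hu1

-- The base `1 / (1 - u)` serves both directions: the lower bound on `x` gives it directly, and the
-- upper bound follows from `1 + u ≤ 1 / (1 - u)`.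
omit F in
theorem near_of_abs_sub_le {x y : ℝ} (hy : 0 ≤ y) (h : |x - y| ≤ u * |y|) :
    Near (growth u) 1 x y := by
  rw [abs_of_nonneg hy, abs_le] at h
  have h1 : 0 < 1 - u := by linarith
  rw [Near, pow_one, growth, inv_mul_eq_div, inv_mul_eq_div, le_div_iff₀ h1, le_div_iff₀ h1]
  constructor
  · nlinarith [mul_nonneg (mul_nonneg hu hu) hy]
  · linarith

variable {x y a b : ℝ} {k l : ℕ}

theorem add_near (hx : x ∈ F.carrier) (hy : y ∈ F.carrier) (ha : 0 ≤ a) (hb : 0 ≤ b)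
    (hxa : Near (growth u) k x a) (hyb : Near (growth u) k y b) :
    Near (growth u) (k + 1) (F.add x y) (a + b) := by
  have hρ := one_le_growth hu hu1
  have hx0 := hxa.nonneg hρ ha
  have hy0 := hyb.nonneg hρ hb
  rw [add_comm k]
  exact (near_of_abs_sub_le hu hu1 (add_nonneg hx0 hy0) (F.add_err x hx y hy)).trans hρ
    (hxa.add hyb)

theorem mul_near (hx : x ∈ F.carrier) (hy : y ∈ F.carrier) (ha : 0 ≤ a) (hb : 0 ≤ b)
    (hxa : Near (growth u) k x a) (hyb : Near (growth u) l y b) :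
    Near (growth u) (k + l + 1) (F.mul x y) (a * b) := by
  have hρ := one_le_growth hu hu1
  have hx0 := hxa.nonneg hρ ha
  have hy0 := hyb.nonneg hρ hb
  rw [add_comm (k + l)]
  exact (near_of_abs_sub_le hu hu1 (mul_nonneg hx0 hy0) (F.mul_err x hx y hy)).trans hρ
    (hxa.mul hρ ha hb hyb)

theorem div_near (hx : x ∈ F.carrier) (hy : y ∈ F.carrier) (ha : 0 ≤ a) (hb : 0 < b)
    (hxa : Near (growth u) k x a) (hyb : Near (growth u) l y b) :
    Near (growth u) (k + l + 1) (F.div x y) (a / b) := by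
  have hρ := one_le_growth hu hu1
  have hx0 := hxa.nonneg hρ ha
  have hy0 := hyb.pos hρ hb
  rw [add_comm (k + l)]
  exact (near_of_abs_sub_le hu hu1 (div_nonneg hx0 hy0.le) (F.div_err x hx y hy hy0.ne')).trans hρ
    (hxa.div hρ ha hb hyb)

omit hu hu1 in
theorem sum_mem {m : ℕ} (x : Fin (m + 1) → ℝ) (hx : ∀ i, x i ∈ F.carrier) :
    F.sum x ∈ F.carrier := by
  induction m with
  | zero => exact hx 0
  | succ m ih => exact F.add_mem _ (ih _ fun i => hx _) _ (hx _)

theorem sum_near {m : ℕ} (x a : Fin (m + 1) → ℝ) (hx : ∀ i, x i ∈ F.carrier) (ha : ∀ i, 0 ≤ a i)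
    (hxa : ∀ i, Near (growth u) k (x i) (a i)) :
    Near (growth u) (k + m) (F.sum x) (∑ i, a i) := by
  have hρ := one_le_growth hu hu1
  induction m with
  | zero => rw [Fin.sum_univ_one]; exact hxa 0
  | succ m ih =>
    rw [Fin.sum_univ_castSucc, ← add_assoc]
    exact F.add_near hu hu1 (F.sum_mem _ fun i => hx _) (hx _)
      (Finset.sum_nonneg fun i _ => ha _) (ha _) (ih _ _ (fun i => hx _) (fun i => ha _)
        fun i => hxa _)
      ((hxa _).mono hρ ((hxa _).nonneg hρ (ha _)) (ha _) (by omega))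

omit hu hu1 in
theorem matMul_mem {n : ℕ} {X Y : Matrix (Fin n) (Fin n) ℝ} (hX : ∀ i j, X i j ∈ F.carrier)
    (hY : ∀ i j, Y i j ∈ F.carrier) (i j : Fin n) : F.matMul X Y i j ∈ F.carrier := by
  cases n with
  | zero => exact i.elim0
  | succ n => exact F.sum_mem _ fun l => F.mul_mem _ (hX _ _) _ (hY _ _)

theorem matMul_near {n : ℕ} {X Y X' Y' : Matrix (Fin n) (Fin n) ℝ}
    (hX : ∀ i j, X i j ∈ F.carrier) (hY : ∀ i j, Y i j ∈ F.carrier)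
    (hX0 : ∀ i j, 0 ≤ X' i j) (hY0 : ∀ i j, 0 ≤ Y' i j)
    (hXX : ∀ i j, Near (growth u) k (X i j) (X' i j))
    (hYY : ∀ i j, Near (growth u) l (Y i j) (Y' i j)) (i j : Fin n) :
    Near (growth u) (k + l + n) (F.matMul X Y i j) ((X' * Y') i j) := by
  cases n with
  | zero => exact i.elim0
  | succ n =>
    have := F.sum_near hu hu1 (fun l => F.mul (X i l) (Y l j)) (fun l => X' i l * Y' l j)
      (fun l => F.mul_mem _ (hX _ _) _ (hY _ _)) (fun l => mul_nonneg (hX0 _ _) (hY0 _ _))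
      (fun l => F.mul_near hu hu1 (hX _ _) (hY _ _) (hX0 _ _) (hY0 _ _) (hXX i l) (hYY l j))
    rw [add_assoc, add_comm 1 n] at this
    exact this

/-- In the recursion for `gthExp`, the term `2 * n * (n + 3)` is the effect on the solution of the
`n + 3` roundings in the data of the reduced system. The term `2 * n + 2` is the back substitution:
`n` for the pivot, `n` for the sum, one multiplication and one division. -/
theorem gthSolve_near {n : ℕ} {N : Matrix (Fin n) (Fin n) ℝ} {w b x : Fin n → ℝ}
    (hNF : ∀ i j, i ≠ j → N i j ∈ F.carrier) (hwF : ∀ i, w i ∈ F.carrier)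
    (hbF : ∀ i, b i ∈ F.carrier) (hN : ∀ i j, i ≠ j → 0 ≤ N i j) (hw : ∀ i, 0 ≤ w i)
    (hb : ∀ i, 0 ≤ b i) (hT : NoTrap N w) (hx : IsSol N w b x) (i : Fin n) :
    F.gthSolve N w b i ∈ F.carrier ∧ Near (growth u) (gthExp n) (F.gthSolve N w b i) (x i) := by
  have hρ := one_le_growth hu hu1
  induction n with
  | zero => exact i.elim0
  | succ n ih =>
    have hd := hT.pivot_pos hN hw
    set d : ℝ := F.sum (Fin.cons (w 0) fun j : Fin n => N 0 j.succ : Fin (n + 1) → ℝ)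
    have hs0 : ∀ j : Fin n, (0 : Fin (n + 1)) ≠ j.succ := fun j => (Fin.succ_ne_zero j).symm
    have hcF : ∀ j, (Fin.cons (w 0) fun j : Fin n => N 0 j.succ : Fin (n + 1) → ℝ) j ∈ F.carrier :=
      Fin.cases (hwF 0) fun j => hNF _ _ (hs0 j)
    have hc0 : ∀ j, 0 ≤ (Fin.cons (w 0) fun j : Fin n => N 0 j.succ : Fin (n + 1) → ℝ) j :=
      Fin.cases (hw 0) fun j => hN _ _ (hs0 j)
    have hdF : d ∈ F.carrier := F.sum_mem _ hcF
    have hdn : Near (growth u) n d (pivot N w) := by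
      have := F.sum_near hu hu1 (k := 0) _ _ hcF hc0 fun j => Near.refl hρ 0 (hc0 j)
      rw [Fin.sum_univ_succ, zero_add] at this
      exact this
    have hd0 : 0 < d := hdn.pos hρ hd
    have hlF : ∀ i : Fin n, F.div (N i.succ 0) d ∈ F.carrier := fun i =>
      F.div_mem _ (hNF _ _ (Fin.succ_ne_zero i)) _ hdF hd0.ne'
    have hl0 : ∀ i : Fin n, 0 ≤ N i.succ 0 / pivot N w := fun i =>
      div_nonneg (hN _ _ (Fin.succ_ne_zero i)) hd.le
    have hln : ∀ i : Fin n,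
        Near (growth u) (0 + n + 1) (F.div (N i.succ 0) d) (N i.succ 0 / pivot N w) := fun i =>
      F.div_near hu hu1 (hNF _ _ (Fin.succ_ne_zero i)) hdF (hN _ _ (Fin.succ_ne_zero i)) hd
        (Near.refl hρ 0 (hN _ _ (Fin.succ_ne_zero i))) hdn
    have upd : ∀ (i : Fin n) {y z : ℝ}, y ∈ F.carrier → z ∈ F.carrier → 0 ≤ y → 0 ≤ z →
        F.add y (F.mul (F.div (N i.succ 0) d) z) ∈ F.carrier ∧ Near (growth u) (n + 3)
          (F.add y (F.mul (F.div (N i.succ 0) d) z)) (y + N i.succ 0 / pivot N w * z) := by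
      intro i y z hy hz hy0 hz0
      have hm := F.mul_mem _ (hlF i) _ hz
      refine ⟨F.add_mem _ hy _ hm, ?_⟩
      have h1 := F.mul_near hu hu1 (hlF i) hz (hl0 i) hz0 (hln i) (Near.refl hρ 0 hz0)
      have h2 := F.add_near hu hu1 hy hm hy0 (mul_nonneg (hl0 i) hz0) (Near.refl hρ _ hy0) h1
      -- The pivot contributes `n`; the division, the multiplication and the addition contribute one
      -- each.
      rw [show n + 3 = 0 + n + 1 + 0 + 1 + 1 by omega]
      exact h2
    have hN' : ∀ i j : Fin n, i ≠ j → _ := fun i j hij =>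
      upd i (hNF i.succ j.succ (by simpa using hij)) (hNF 0 j.succ (hs0 j))
        (hN i.succ j.succ (by simpa using hij)) (hN 0 j.succ (hs0 j))
    have hw' : ∀ i : Fin n, _ := fun i => upd i (hwF i.succ) (hwF 0) (hw _) (hw _)
    have hb' : ∀ i : Fin n, _ := fun i => upd i (hbF i.succ) (hbF 0) (hb _) (hb _)
    set N' : Matrix (Fin n) (Fin n) ℝ :=
      fun i j => F.add (N i.succ j.succ) (F.mul (F.div (N i.succ 0) d) (N 0 j.succ))
    set w' : Fin n → ℝ := fun i => F.add (w i.succ) (F.mul (F.div (N i.succ 0) d) (w 0))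
    set b' : Fin n → ℝ := fun i => F.add (b i.succ) (F.mul (F.div (N i.succ 0) d) (b 0))
    have eN := elimMatrix_nonneg hN hd
    have ew := elimVector_nonneg hN hd hw
    have eb := elimVector_nonneg hN hd hb
    have eT := hT.elim hN hw
    have hN0' : ∀ i j, i ≠ j → 0 ≤ N' i j := fun i j h => (hN' i j h).2.nonneg hρ (eN i j h)
    have hw0' : ∀ i, 0 ≤ w' i := fun i => (hw' i).2.nonneg hρ (ew i)
    have hb0' : ∀ i, 0 ≤ b' i := fun i => (hb' i).2.nonneg hρ (eb i)
    have hT' : NoTrap N' w' :=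
      eT.of_ne_zero (fun i j h => (hN' i j h).2.ne_zero (eN i j h))
        fun i => (hw' i).2.ne_zero (ew i)
    -- `y` solves the computed reduced system exactly. The induction hypothesis compares the output
    -- with `y`, and `IsSol.near` compares `y` with the tail of the true solution.
    obtain ⟨y, hy⟩ := hT'.exists_isSol hN0' hw0' b'
    have hx0 := hT.nonneg hN hw hb hx
    have ht := hx.tail hd.ne'
    have htail : ∀ i : Fin n, F.gthSolve N' w' b' i ∈ F.carrier ∧
        Near (growth u) (gthExp n + 2 * n * (n + 3)) (F.gthSolve N' w' b' i) (x i.succ) := by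
      intro i
      obtain ⟨h1, h2⟩ := ih (fun i j h => (hN' i j h).1) (fun i => (hw' i).1) (fun i => (hb' i).1)
        hN0' hw0' hb0' hT' hy i
      refine ⟨h1, ?_⟩
      have h3 := ht.near hρ eT eN ew eb Finset.univ (fun i hi => absurd (Finset.mem_univ i) hi)
        (fun i j h => (hN' i j h).2) (fun i => (hw' i).2) (fun i => (hb' i).2) hy i
      rw [Finset.card_univ, Fintype.card_fin, mul_right_comm] at h3
      exact h2.trans hρ h3
    have hunf : F.gthSolve N w b = Fin.cons
        (F.div (F.sum (Fin.cons (b 0) fun j : Fin n => F.mul (N 0 j.succ)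
          (F.gthSolve N' w' b' j) : Fin (n + 1) → ℝ)) d) (F.gthSolve N' w' b') := rfl
    rw [hunf, gthExp]
    refine Fin.cases ?_ ?_ i
    · rw [Fin.cons_zero]
      set E := gthExp n + 2 * n * (n + 3)
      have hF : ∀ j, (Fin.cons (b 0) fun j : Fin n => F.mul (N 0 j.succ)
          (F.gthSolve N' w' b' j) : Fin (n + 1) → ℝ) j ∈ F.carrier :=
        Fin.cases (hbF 0) fun j => F.mul_mem _ (hNF _ _ (hs0 j)) _ (htail j).1
      have h0 : ∀ j, 0 ≤ (Fin.cons (b 0) fun j : Fin n => N 0 j.succ * x j.succ :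
          Fin (n + 1) → ℝ) j :=
        Fin.cases (hb 0) fun j => mul_nonneg (hN _ _ (hs0 j)) (hx0 _)
      have hn := F.sum_near hu hu1 (k := E + 1) _ _ hF h0 (Fin.cases (Near.refl hρ _ (hb 0))
        fun j => by
          have := F.mul_near hu hu1 (hNF _ _ (hs0 j)) (htail j).1 (hN _ _ (hs0 j)) (hx0 _)
            (Near.refl hρ 0 (hN _ _ (hs0 j))) (htail j).2
          rw [zero_add] at this
          exact this)
      have hsF := F.sum_mem _ hF
      refine ⟨F.div_mem _ hsF _ hdF hd0.ne', ?_⟩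
      have h3 := F.div_near hu hu1 hsF hdF (Finset.sum_nonneg fun j _ => h0 j) hd hn hdn
      rw [Fin.sum_univ_succ] at h3
      simp only [Fin.cons_zero, Fin.cons_succ] at h3
      rw [← hx.row_zero, mul_div_cancel_left₀ _ hd.ne'] at h3
      rw [show E + (2 * n + 2) = E + 1 + n + n + 1 by omega]
      exact h3
    · intro j
      rw [Fin.cons_succ]
      exact ⟨(htail j).1, (htail j).2.mono hρ ((htail j).2.nonneg hρ (hx0 _)) (hx0 _) (by omega)⟩

end FloatArith

open Matrix

namespace Tuple

variable {n : ℕ}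

/-! ### Exact Cyclic Reduction on tuples -/

/-- The row sums `(A + C) 1`. -/
def rowSum (S : Tuple n) (i : Fin n) : ℝ := ∑ j, (S.A i j + S.C i j)

/-- The matrix `B` of a tuple, with the diagonal recovered from `(A - B + C) 1 = 0`. -/
def B (S : Tuple n) : Matrix (Fin n) (Fin n) ℝ :=
  diagonal (fun i => S.rowSum i + ∑ j, S.negB i j) - S.negB

/-- Every nonempty finite set of nodes of the bi-infinite graph has an exit. -/
def NoFiniteTrap (S : Tuple n) : Prop :=
  ∀ J : Set (ℤ × Fin n), J.Finite → J.Nonempty → ∃ l i, (l, i) ∈ J ∧ ∃ j,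
    ((l - 1, j) ∉ J ∧ S.A i j ≠ 0) ∨ ((l, j) ∉ J ∧ S.negB i j ≠ 0) ∨
      ((l + 1, j) ∉ J ∧ S.C i j ≠ 0)

/-- Entrywise nonnegative tuples with zero diagonals whose bi-infinite graph has no finite trap. -/
structure Regular (S : Tuple n) : Prop where
  A_nonneg : ∀ i j, 0 ≤ S.A i j
  negB_nonneg : ∀ i j, 0 ≤ S.negB i j
  negBhat_nonneg : ∀ i j, 0 ≤ S.negBhat i j
  C_nonneg : ∀ i j, 0 ≤ S.C i j
  negB_diag : ∀ i, S.negB i i = 0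
  negBhat_diag : ∀ i, S.negBhat i i = 0
  noFiniteTrap : S.NoFiniteTrap

/-- One exact step of Cyclic Reduction. -/
noncomputable def cr (S : Tuple n) : Tuple n where
  A := S.A * (S.B⁻¹ * S.A)
  negB := fun i j => if i = j then 0 else
    S.negB i j + (S.A * (S.B⁻¹ * S.C)) i j + (S.C * (S.B⁻¹ * S.A)) i j
  negBhat := fun i j => if i = j then 0 else S.negBhat i j + (S.C * (S.B⁻¹ * S.A)) i j
  C := S.C * (S.B⁻¹ * S.C)

theorem mulVec_eq (M : Matrix (Fin n) (Fin n) ℝ) (x : Fin n → ℝ) (i : Fin n) :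
    (M *ᵥ x) i = ∑ j, M i j * x j := rfl

theorem B_apply_ne (S : Tuple n) {i j : Fin n} (h : i ≠ j) : S.B i j = -S.negB i j := by
  rw [B, Matrix.sub_apply, diagonal_apply_ne _ h, zero_sub]

theorem eq_of_offdiag_of_mulVec_one {M M' : Matrix (Fin n) (Fin n) ℝ}
    (hoff : ∀ i j, i ≠ j → M i j = M' i j) (hsum : M *ᵥ 1 = M' *ᵥ 1) : M = M' := by
  ext i j
  by_cases h : i = j
  · subst h
    have := congrFun hsum i
    simp only [mulVec, dotProduct, Pi.one_apply, mul_one] at this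
    rw [← Finset.add_sum_erase _ _ (Finset.mem_univ i),
      ← Finset.add_sum_erase (a := i) _ _ (Finset.mem_univ i),
      Finset.sum_congr rfl fun j hj => hoff i j (Finset.ne_of_mem_erase hj).symm] at this
    exact add_right_cancel this
  · exact hoff i j h

theorem B_mulVec (S : Tuple n) (x : Fin n → ℝ) (i : Fin n) :
    (S.B *ᵥ x) i = S.rowSum i * x i + ∑ j, S.negB i j * (x i - x j) := by
  rw [B, sub_mulVec, Pi.sub_apply, mulVec_diagonal, mulVec_eq]
  simp only [mul_sub, Finset.sum_sub_distrib, ← Finset.sum_mul]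
  ring

theorem isSol_iff {S : Tuple n} {b x : Fin n → ℝ} :
    IsSol S.negB S.rowSum b x ↔ S.B *ᵥ x = b :=
  ⟨fun h => funext fun i => (S.B_mulVec x i).trans (h i),
    fun h i => (S.B_mulVec x i).symm.trans (congrFun h i)⟩

theorem rowSum_eq (S : Tuple n) : S.rowSum = S.A *ᵥ 1 + S.C *ᵥ 1 := by
  ext i
  simp [rowSum, mulVec, dotProduct, Finset.sum_add_distrib]

theorem B_mulVec_one (S : Tuple n) : S.B *ᵥ 1 = S.A *ᵥ 1 + S.C *ᵥ 1 := by
  rw [← rowSum_eq]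
  ext i
  simp [B_mulVec]

namespace Regular

variable {S : Tuple n} (hS : S.Regular)

include hS

theorem rowSum_nonneg (i : Fin n) : 0 ≤ S.rowSum i :=
  Finset.sum_nonneg fun j _ => add_nonneg (hS.A_nonneg i j) (hS.C_nonneg i j)

/-- A set of indices is placed on level `0` of the bi-infinite graph; an exit to another level is a
nonzero entry of `A` or `C`, hence a nonzero row sum. -/
theorem noTrap : NoTrap S.negB S.rowSum := by
  rintro J ⟨i₀, hi₀⟩
  obtain ⟨l, i, hi, j, h⟩ := hS.noFiniteTrap {p | p.1 = 0 ∧ p.2 ∈ J}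
    (((Set.finite_singleton (0 : ℤ)).prod J.toFinite).subset fun p hp => ⟨hp.1, hp.2⟩)
    ⟨(0, i₀), rfl, hi₀⟩
  obtain ⟨rfl, hi⟩ : l = 0 ∧ i ∈ J := hi
  have hpos : 0 < S.A i j + S.C i j → S.rowSum i ≠ 0 := fun h =>
    (Finset.sum_pos' (fun j _ => add_nonneg (hS.A_nonneg i j) (hS.C_nonneg i j))
      ⟨j, Finset.mem_univ j, h⟩).ne'
  refine ⟨i, hi, ?_⟩
  rcases h with ⟨-, h⟩ | ⟨hj, h⟩ | ⟨-, h⟩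
  · exact Or.inl (hpos (add_pos_of_pos_of_nonneg ((hS.A_nonneg i j).lt_of_ne' h)
      (hS.C_nonneg i j)))
  · exact Or.inr ⟨j, fun hj' => hj ⟨rfl, hj'⟩, h⟩
  · exact Or.inl (hpos (add_pos_of_nonneg_of_pos (hS.A_nonneg i j)
      ((hS.C_nonneg i j).lt_of_ne' h)))

theorem isUnit_B : IsUnit S.B := by
  rw [← mulVec_injective_iff_isUnit]
  intro x y h
  exact hS.noTrap.isSol_unique (fun i j _ => hS.negB_nonneg i j) hS.rowSum_nonneg
    (isSol_iff.2 h) (isSol_iff.2 rfl)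

theorem isUnit_det_B : IsUnit S.B.det := (isUnit_iff_isUnit_det _).1 hS.isUnit_B

theorem isSol_inv (b : Fin n → ℝ) : IsSol S.negB S.rowSum b (S.B⁻¹ *ᵥ b) :=
  isSol_iff.2 (by rw [mulVec_mulVec, mul_nonsing_inv _ hS.isUnit_det_B, one_mulVec])

theorem inv_mulVec_nonneg {b : Fin n → ℝ} (hb : ∀ i, 0 ≤ b i) (i : Fin n) :
    0 ≤ (S.B⁻¹ *ᵥ b) i :=
  hS.noTrap.nonneg (fun i j _ => hS.negB_nonneg i j) hS.rowSum_nonneg hb (hS.isSol_inv b) i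

theorem isSol_inv_mul (M : Matrix (Fin n) (Fin n) ℝ) (j : Fin n) :
    IsSol S.negB S.rowSum (fun i => M i j) fun i => (S.B⁻¹ * M) i j :=
  hS.isSol_inv fun i => M i j

theorem inv_mul_nonneg {M : Matrix (Fin n) (Fin n) ℝ} (hM : ∀ i j, 0 ≤ M i j) (i j : Fin n) :
    0 ≤ (S.B⁻¹ * M) i j :=
  hS.inv_mulVec_nonneg (b := fun i => M i j) (fun i => hM i j) i

theorem inv_mulVec_one : (S.B⁻¹ * S.A) *ᵥ 1 + (S.B⁻¹ * S.C) *ᵥ 1 = 1 := by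
  rw [← mulVec_mulVec, ← mulVec_mulVec, ← mulVec_add, ← B_mulVec_one, mulVec_mulVec,
    nonsing_inv_mul _ hS.isUnit_det_B, one_mulVec]

/-- The off-diagonal entries agree by construction. The row sums agree because `B⁻¹ A 1 + B⁻¹ C 1 =
1`, so Cyclic Reduction preserves `(A - B + C) 1 = 0` and the diagonal recovered from row sums is
the true one. -/
theorem cr_B : S.cr.B = S.B - S.A * (S.B⁻¹ * S.C) - S.C * (S.B⁻¹ * S.A) := by
  have hoff : ∀ i j, i ≠ j →
      S.cr.B i j = (S.B - S.A * (S.B⁻¹ * S.C) - S.C * (S.B⁻¹ * S.A)) i j := by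
    intro i j h
    rw [Matrix.sub_apply, Matrix.sub_apply, B_apply_ne _ h, B_apply_ne _ h]
    simp only [cr, if_neg h]
    ring
  have hsum : S.cr.B *ᵥ 1 = (S.B - S.A * (S.B⁻¹ * S.C) - S.C * (S.B⁻¹ * S.A)) *ᵥ 1 := by
    have h1 : (S.B⁻¹ * S.A) *ᵥ 1 = 1 - (S.B⁻¹ * S.C) *ᵥ 1 := eq_sub_of_add_eq hS.inv_mulVec_one
    rw [B_mulVec_one, sub_mulVec, sub_mulVec, B_mulVec_one]
    simp only [cr]
    rw [← mulVec_mulVec 1 S.A (S.B⁻¹ * S.A), ← mulVec_mulVec 1 S.C (S.B⁻¹ * S.A), h1,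
      mulVec_sub, mulVec_sub, mulVec_mulVec, mulVec_mulVec]
    abel
  exact eq_of_offdiag_of_mulVec_one hoff hsum

end Regular

/-! ### Harmonic sequences -/

/-- Block row `l` of the bi-infinite system. -/
def residual (S : Tuple n) (x : ℤ → Fin n → ℝ) (l : ℤ) : Fin n → ℝ :=
  S.B *ᵥ x l - S.A *ᵥ x (l - 1) - S.C *ᵥ x (l + 1)

theorem residual_apply (S : Tuple n) (x : ℤ → Fin n → ℝ) (l : ℤ) (i : Fin n) :
    S.residual x l i = ∑ j, S.A i j * (x l i - x (l - 1) j) +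
      ∑ j, S.negB i j * (x l i - x l j) + ∑ j, S.C i j * (x l i - x (l + 1) j) := by
  rw [residual, Pi.sub_apply, Pi.sub_apply, B_mulVec, mulVec_eq, mulVec_eq]
  simp only [rowSum, mul_sub, Finset.sum_sub_distrib, Finset.sum_add_distrib, ← Finset.sum_mul]
  ring

/-- Extension of a sequence from the even levels to all levels, solving the odd block rows. -/
noncomputable def fill (S : Tuple n) (x : ℤ → Fin n → ℝ) (l : ℤ) : Fin n → ℝ :=
  if Even l then x (l / 2) else (S.B⁻¹ * S.A) *ᵥ x (l / 2) + (S.B⁻¹ * S.C) *ᵥ x (l / 2 + 1)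

theorem fill_even (S : Tuple n) (x : ℤ → Fin n → ℝ) (l : ℤ) : S.fill x (2 * l) = x l := by
  rw [fill, if_pos (even_two_mul l), Int.mul_ediv_cancel_left _ two_ne_zero]

theorem fill_odd (S : Tuple n) (x : ℤ → Fin n → ℝ) (l : ℤ) :
    S.fill x (2 * l + 1) = (S.B⁻¹ * S.A) *ᵥ x l + (S.B⁻¹ * S.C) *ᵥ x (l + 1) := by
  rw [fill, if_neg (by rw [Int.not_even_iff_odd]; exact odd_two_mul_add_one l),
    show (2 * l + 1) / 2 = l by omega]

theorem residual_fill_odd {S : Tuple n} (hS : S.Regular) (x : ℤ → Fin n → ℝ) (l : ℤ) :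
    S.residual (S.fill x) (2 * l + 1) = 0 := by
  rw [residual, fill_odd, show 2 * l + 1 - 1 = 2 * l by ring,
    show 2 * l + 1 + 1 = 2 * (l + 1) by ring, fill_even, fill_even, mulVec_add, mulVec_mulVec,
    mulVec_mulVec, mul_nonsing_inv_cancel_left _ _ hS.isUnit_det_B,
    mul_nonsing_inv_cancel_left _ _ hS.isUnit_det_B]
  abel

/-- Cyclic Reduction is block elimination of the odd levels: once their equations are solved, the
even block rows form the system of `S.cr`. -/
theorem residual_fill_even {S : Tuple n} (hS : S.Regular) (x : ℤ → Fin n → ℝ) (l : ℤ) :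
    S.residual (S.fill x) (2 * l) = S.cr.residual x l := by
  rw [residual, residual, fill_odd, show 2 * l - 1 = 2 * (l - 1) + 1 by ring, fill_even, fill_odd,
    sub_add_cancel, hS.cr_B, sub_mulVec, sub_mulVec]
  simp only [cr, mulVec_add, mulVec_mulVec]
  abel

/-- Maximum principle. The indicator function of a finite trap of `S.cr`, filled in on the odd
levels, is at most `1`, and it equals `1` only on a finite set. The residual vanishes there, which
forces every neighbour of such a node to have value `1` as well. The set is then a finite trap of
`S`. -/
theorem Regular.cr_noFiniteTrap {S : Tuple n} (hS : S.Regular) : S.cr.NoFiniteTrap := by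
  classical
  intro J hJ hne
  by_contra! hcl
  set f : ℤ → Fin n → ℝ := fun l i => if (l, i) ∈ J then 1 else 0 with hf
  have hf1 : ∀ l i, f l i ≤ 1 := fun l i => by simp only [hf]; split_ifs <;> norm_num
  have hfJ : ∀ l i, f l i = 1 ↔ (l, i) ∈ J := fun l i => by simp [hf]
  have hX := hS.inv_mul_nonneg hS.A_nonneg
  have hY := hS.inv_mul_nonneg hS.C_nonneg
  set x := S.fill f with hx
  have hx1 : ∀ l i, x l i ≤ 1 := by
    intro l i
    rcases Int.even_or_odd' l with ⟨m, rfl | rfl⟩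
    · rw [hx, fill_even]; exact hf1 _ _
    · have h1 := congrFun hS.inv_mulVec_one i
      rw [Pi.add_apply, mulVec_eq, mulVec_eq] at h1
      rw [hx, fill_odd, Pi.add_apply, mulVec_eq, mulVec_eq]
      refine le_trans (add_le_add ?_ ?_) h1.le <;> refine Finset.sum_le_sum fun j _ => ?_
      · exact mul_le_mul_of_nonneg_left (hf1 _ _) (hX i j)
      · exact mul_le_mul_of_nonneg_left (hf1 _ _) (hY i j)
  have hfin : {p : ℤ × Fin n | x p.1 p.2 = 1}.Finite := by
    have h1 : ((Prod.fst '' J) : Set ℤ).Finite := hJ.image _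
    have h2 := ((h1.image fun l => 2 * l).union
      ((h1.image fun l => 2 * l + 1).union (h1.image fun l => 2 * l - 1))).prod
        (Set.finite_univ (α := Fin n))
    refine h2.subset ?_
    rintro ⟨l, i⟩ hp
    refine ⟨?_, Set.mem_univ _⟩
    simp only [Set.mem_ofPred_eq] at hp
    rcases Int.even_or_odd' l with ⟨m, rfl | rfl⟩
    · rw [hx, fill_even, hfJ] at hp
      exact Or.inl ⟨m, ⟨_, hp, rfl⟩, rfl⟩
    · by_cases h : ∃ j, (m, j) ∈ J
      · obtain ⟨j, hj⟩ := h
        exact Or.inr (Or.inl ⟨m, ⟨_, hj, rfl⟩, rfl⟩)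
      by_cases h' : ∃ j, (m + 1, j) ∈ J
      · obtain ⟨j, hj⟩ := h'
        exact Or.inr (Or.inr ⟨m + 1, ⟨_, hj, rfl⟩, by ring⟩)
      push Not at h h'
      have e1 : f m = 0 := funext fun j => by simp [hf, h j]
      have e2 : f (m + 1) = 0 := funext fun j => by simp [hf, h' j]
      rw [hx, fill_odd, e1, e2] at hp
      simp at hp
  obtain ⟨⟨l₀, i₀⟩, h₀⟩ := hne
  obtain ⟨l, i, hli, j, h⟩ := hS.noFiniteTrap _ hfin
    ⟨(2 * l₀, i₀), by simp only [Set.mem_ofPred_eq]; rw [hx, fill_even, hfJ]; exact h₀⟩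
  simp only [Set.mem_ofPred_eq] at hli h
  have hres : S.residual x l i = 0 := by
    rcases Int.even_or_odd' l with ⟨m, rfl | rfl⟩
    · rw [hx, fill_even, hfJ] at hli
      rw [hx, residual_fill_even hS, residual_apply]
      have key : ∀ {c : ℝ} {q : ℤ × Fin n}, (q ∉ J → c = 0) → c * (f m i - f q.1 q.2) = 0 := by
        intro c q hq
        by_cases hqJ : q ∈ J
        · rw [(hfJ m i).2 hli, (hfJ q.1 q.2).2 hqJ, sub_self, mul_zero]
        · rw [hq hqJ, zero_mul]
      rw [Finset.sum_eq_zero, Finset.sum_eq_zero, Finset.sum_eq_zero]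
      · norm_num
      · exact fun j _ => key (q := (m + 1, j)) (hcl m i hli j).2.2
      · exact fun j _ => key (q := (m, j)) (hcl m i hli j).2.1
      · exact fun j _ => key (q := (m - 1, j)) (hcl m i hli j).1
    · rw [hx, residual_fill_odd hS, Pi.zero_apply]
  rw [residual_apply, hli] at hres
  have tA : ∀ j, 0 ≤ S.A i j * (1 - x (l - 1) j) := fun j =>
    mul_nonneg (hS.A_nonneg i j) (sub_nonneg.2 (hx1 _ _))
  have tB : ∀ j, 0 ≤ S.negB i j * (1 - x l j) := fun j =>
    mul_nonneg (hS.negB_nonneg i j) (sub_nonneg.2 (hx1 _ _))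
  have tC : ∀ j, 0 ≤ S.C i j * (1 - x (l + 1) j) := fun j =>
    mul_nonneg (hS.C_nonneg i j) (sub_nonneg.2 (hx1 _ _))
  have sA := Finset.sum_nonneg fun j (_ : j ∈ Finset.univ) => tA j
  have sB := Finset.sum_nonneg fun j (_ : j ∈ Finset.univ) => tB j
  have sC := Finset.sum_nonneg fun j (_ : j ∈ Finset.univ) => tC j
  have fin : ∀ {c y : ℝ}, ¬ y = 1 ∧ c ≠ 0 → c * (1 - y) ≠ 0 := fun h =>
    mul_ne_zero h.2 (sub_ne_zero.2 (Ne.symm h.1))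
  rcases h with h | h | h
  · exact fin h ((Finset.sum_eq_zero_iff_of_nonneg fun j _ => tA j).1 (by linarith) j
      (Finset.mem_univ j))
  · exact fin h ((Finset.sum_eq_zero_iff_of_nonneg fun j _ => tB j).1 (by linarith) j
      (Finset.mem_univ j))
  · exact fin h ((Finset.sum_eq_zero_iff_of_nonneg fun j _ => tC j).1 (by linarith) j
      (Finset.mem_univ j))

theorem mul_entry_nonneg {M M' : Matrix (Fin n) (Fin n) ℝ} (hM : ∀ i j, 0 ≤ M i j)
    (hM' : ∀ i j, 0 ≤ M' i j) (i j : Fin n) : 0 ≤ (M * M') i j := by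
  rw [mul_apply]
  exact Finset.sum_nonneg fun l _ => mul_nonneg (hM i l) (hM' l j)

theorem Regular.cr {S : Tuple n} (hS : S.Regular) : S.cr.Regular where
  A_nonneg := mul_entry_nonneg hS.A_nonneg (hS.inv_mul_nonneg hS.A_nonneg)
  C_nonneg := mul_entry_nonneg hS.C_nonneg (hS.inv_mul_nonneg hS.C_nonneg)
  negB_nonneg i j := by
    simp only [Tuple.cr]
    split_ifs
    · rfl
    · exact add_nonneg (add_nonneg (hS.negB_nonneg i j)
        (mul_entry_nonneg hS.A_nonneg (hS.inv_mul_nonneg hS.C_nonneg) i j))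
        (mul_entry_nonneg hS.C_nonneg (hS.inv_mul_nonneg hS.A_nonneg) i j)
  negBhat_nonneg i j := by
    simp only [Tuple.cr]
    split_ifs
    · rfl
    · exact add_nonneg (hS.negBhat_nonneg i j)
        (mul_entry_nonneg hS.C_nonneg (hS.inv_mul_nonneg hS.A_nonneg) i j)
  negB_diag i := if_pos rfl
  negBhat_diag i := if_pos rfl
  noFiniteTrap := hS.cr_noFiniteTrap

theorem Regular.iterate_cr {S : Tuple n} (hS : S.Regular) (k : ℕ) : (Tuple.cr^[k] S).Regular := by
  induction k generalizing S with
  | zero => exact hS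
  | succ k ih => exact ih hS.cr

/-! ### Dirichlet problems -/

/-- The increment of `-B̂` in `k` steps of Cyclic Reduction. -/
noncomputable def rightIncr : ℕ → Tuple n → Matrix (Fin n) (Fin n) ℝ
  | 0, _ => 0
  | k + 1, S => S.C * (S.B⁻¹ * S.A) + rightIncr k S.cr

/-- The part of the increment of `-B` in `k` steps that stems from the terms `A B⁻¹ C`. -/
noncomputable def leftIncr : ℕ → Tuple n → Matrix (Fin n) (Fin n) ℝ
  | 0, _ => 0
  | k + 1, S => S.A * (S.B⁻¹ * S.C) + leftIncr k S.cr

theorem iterate_cr_negB {S : Tuple n} (k : ℕ) {i j : Fin n} (hij : i ≠ j) :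
    (cr^[k] S).negB i j = S.negB i j + leftIncr k S i j + rightIncr k S i j := by
  induction k generalizing S with
  | zero => simp [leftIncr, rightIncr]
  | succ k ih =>
    rw [Function.iterate_succ_apply, ih, leftIncr, rightIncr, Matrix.add_apply, Matrix.add_apply]
    simp only [cr, if_neg hij]
    ring

theorem iterate_cr_negBhat {S : Tuple n} (k : ℕ) {i j : Fin n} (hij : i ≠ j) :
    (cr^[k] S).negBhat i j = S.negBhat i j + rightIncr k S i j := by
  induction k generalizing S with
  | zero => simp [rightIncr]
  | succ k ih =>
    rw [Function.iterate_succ_apply, ih, rightIncr, Matrix.add_apply]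
    simp only [cr, if_neg hij]
    ring

/-- For unit vectors `a` and `c`, the last two identities read off the columns of the matrices after
`k` steps from the values next to the two boundary levels. The induction fills in a solution of the
problem for `S.cr`, which doubles the number of levels. -/
theorem Regular.exists_dirichlet {S : Tuple n} (hS : S.Regular) (k : ℕ) (a c : Fin n → ℝ) :
    ∃ x : ℤ → Fin n → ℝ, x 0 = a ∧ x (2 ^ k) = c ∧
      (∀ l, 0 < l → l < 2 ^ k → S.residual x l = 0) ∧
      S.C *ᵥ x 1 = rightIncr k S *ᵥ a + (Tuple.cr^[k] S).C *ᵥ c ∧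
      S.A *ᵥ x (2 ^ k - 1) = (Tuple.cr^[k] S).A *ᵥ a + leftIncr k S *ᵥ c := by
  induction k generalizing S with
  | zero =>
    refine ⟨fun l => if l = 0 then a else c, by simp, by simp, fun l h h' => ?_, ?_, ?_⟩
    · rw [pow_zero] at h'; omega
    · simp [rightIncr]
    · simp [leftIncr]
  | succ k ih =>
    obtain ⟨x, h0, h1, hres, hC, hA⟩ := ih hS.cr
    refine ⟨S.fill x, ?_, ?_, fun l hl hl' => ?_, ?_, ?_⟩
    · rw [← h0, ← S.fill_even x 0, mul_zero]
    · rw [pow_succ', fill_even, h1]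
    · rw [pow_succ'] at hl'
      rcases Int.even_or_odd' l with ⟨m, rfl | rfl⟩
      · rw [residual_fill_even hS]
        exact hres m (by omega) (by omega)
      · exact residual_fill_odd hS x m
    · have h := S.fill_odd x 0
      rw [mul_zero, zero_add] at h
      rw [h, mulVec_add, mulVec_mulVec, mulVec_mulVec, h0, rightIncr, add_mulVec,
        Function.iterate_succ_apply, add_assoc, ← hC]
      rfl
    · have h := S.fill_odd x (2 ^ k - 1)
      rw [show (2 * (2 ^ k - 1) + 1 : ℤ) = 2 ^ (k + 1) - 1 by ring, sub_add_cancel, h1] at h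
      rw [h, mulVec_add, mulVec_mulVec, mulVec_mulVec, leftIncr, add_mulVec,
        Function.iterate_succ_apply, add_comm (_ *ᵥ c), ← add_assoc, ← hA]
      rfl

/-! ### The Dirichlet problem as a finite system -/

/-- Off-diagonal part of the Dirichlet problem on the levels `0, …, L`. -/
def levelMatrix (S : Tuple n) (L : ℕ) (p q : Fin (L + 1) × Fin n) : ℝ :=
  if p.1 ∈ Finset.Ioo 0 (Fin.last L) then
    (if (q.1 : ℕ) + 1 = p.1 then S.A p.2 q.2 else 0) + (if q.1 = p.1 then S.negB p.2 q.2 else 0) +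
      (if (q.1 : ℕ) = p.1 + 1 then S.C p.2 q.2 else 0)
  else 0

/-- Row sums of the Dirichlet problem on the levels `0, …, L`. -/
def levelRowSum (L : ℕ) (p : Fin (L + 1) × Fin n) : ℝ :=
  if p.1 ∈ Finset.Ioo 0 (Fin.last L) then 0 else 1

/-- Right-hand side of the Dirichlet problem on the levels `0, …, L`. -/
def levelRhs (L : ℕ) (x : ℤ → Fin n → ℝ) (p : Fin (L + 1) × Fin n) : ℝ :=
  if p.1 ∈ Finset.Ioo 0 (Fin.last L) then 0 else x (p.1 : ℕ) p.2

/-- Boundary rows are identity rows prescribing the value. Interior rows have row sum `0` by `(A - B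
+ C) 1 = 0`. -/
theorem levelMatrix_isSol {S : Tuple n} {L : ℕ} {x : ℤ → Fin n → ℝ}
    (hx : ∀ l : ℤ, 0 < l → l < L → S.residual x l = 0) :
    IsSol (S.levelMatrix L) (levelRowSum L) (levelRhs L x) fun p => x (p.1 : ℕ) p.2 := by
  rintro ⟨l, i⟩
  by_cases hl : l ∈ Finset.Ioo 0 (Fin.last L)
  · simp only [tripletApply, levelMatrix, levelRowSum, levelRhs, if_pos hl]
    rw [Finset.mem_Ioo, Fin.lt_def, Fin.lt_def, Fin.val_zero, Fin.val_last] at hl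
    obtain ⟨m, hm⟩ : ∃ m, (l : ℕ) = m + 1 := ⟨l - 1, by omega⟩
    have h := congrFun (hx (l : ℕ) (by omega) (by omega)) i
    rw [residual_apply, Pi.zero_apply] at h
    refine Eq.trans ?_ h
    rw [zero_mul, zero_add, Fintype.sum_prod_type]
    simp only [add_mul, ite_mul, zero_mul, Finset.sum_add_distrib]
    congr 1
    · congr 1
      · rw [Finset.sum_eq_single ⟨m, by omega⟩]
        · refine Finset.sum_congr rfl fun j _ => ?_
          rw [if_pos hm.symm, hm]
          push_cast
          rw [add_sub_cancel_right]
        · intro q _ hq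
          refine Finset.sum_eq_zero fun j _ => if_neg fun e => hq (Fin.ext ?_)
          simp only
          omega
        · simp
      · rw [Finset.sum_eq_single l]
        · exact Finset.sum_congr rfl fun j _ => if_pos rfl
        · exact fun q _ hq => Finset.sum_eq_zero fun j _ => if_neg hq
        · simp
    · rw [Finset.sum_eq_single ⟨l + 1, by omega⟩]
      · refine Finset.sum_congr rfl fun j _ => ?_
        rw [if_pos rfl]
        push_cast
        rfl
      · exact fun q _ hq => Finset.sum_eq_zero fun j _ => if_neg fun e => hq (Fin.ext e)
      · simp
  · simp [tripletApply, levelMatrix, levelRowSum, levelRhs, hl]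

theorem Regular.levelMatrix_nonneg {S : Tuple n} (hS : S.Regular) (L : ℕ)
    (p q : Fin (L + 1) × Fin n) : 0 ≤ S.levelMatrix L p q := by
  have := hS.A_nonneg p.2 q.2
  have := hS.negB_nonneg p.2 q.2
  have := hS.C_nonneg p.2 q.2
  rw [levelMatrix]
  split_ifs <;> positivity

theorem Regular.levelMatrix_noTrap {S : Tuple n} (hS : S.Regular) (L : ℕ) :
    NoTrap (S.levelMatrix L) (levelRowSum L) := by
  rintro J ⟨p₀, hp₀⟩
  by_cases hb : ∃ p ∈ J, p.1 ∉ Finset.Ioo 0 (Fin.last L)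
  · obtain ⟨p, hp, h⟩ := hb
    exact ⟨p, hp, Or.inl (by simp [levelRowSum, h])⟩
  push Not at hb
  -- All levels of `J` are now interior, so the exit ends on a level between `0` and `L` and is an
  -- edge of the finite system.
  obtain ⟨l, i, hli, j, h⟩ := hS.noFiniteTrap ((fun p : Fin (L + 1) × Fin n =>
    (((p.1 : ℕ) : ℤ), p.2)) '' J) (J.toFinite.image _) ⟨_, p₀, hp₀, rfl⟩
  obtain ⟨⟨l', i'⟩, hp, e⟩ := hli
  simp only [Prod.mk.injEq] at e
  obtain ⟨rfl, rfl⟩ := e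
  have hl := hb _ hp
  have hl' := hl
  rw [Finset.mem_Ioo, Fin.lt_def, Fin.lt_def, Fin.val_zero, Fin.val_last] at hl'
  simp only at hl'
  have hA := hS.A_nonneg i' j
  have hB := hS.negB_nonneg i' j
  have hC := hS.C_nonneg i' j
  refine ⟨_, hp, Or.inr ?_⟩
  rcases h with ⟨hj, h⟩ | ⟨hj, h⟩ | ⟨hj, h⟩
  · refine ⟨(⟨l' - 1, by omega⟩, j), fun hq => hj ⟨_, hq, ?_⟩, ?_⟩
    · simp only [Prod.mk.injEq, and_true]; omega
    · have e : ((l' : ℕ) - 1) + 1 = l' := by omega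
      simp only [levelMatrix, if_pos hl, if_pos e]
      have := hA.lt_of_ne' h
      split_ifs <;> positivity
  · refine ⟨(l', j), fun hq => hj ⟨_, hq, rfl⟩, ?_⟩
    simp only [levelMatrix, if_pos hl, if_true]
    have := hB.lt_of_ne' h
    split_ifs <;> positivity
  · refine ⟨(⟨l' + 1, by omega⟩, j), fun hq => hj ⟨_, hq, ?_⟩, ?_⟩
    · simp
    · simp only [levelMatrix, if_pos hl, if_true]
      have := hC.lt_of_ne' h
      split_ifs <;> positivity

/-! ### Perturbation of Cyclic Reduction -/

/-- Entrywise closeness of all four components. -/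
structure Near (ρ : ℝ) (k : ℕ) (S S' : Tuple n) : Prop where
  A : ∀ i j, CyclicReduction.Near ρ k (S.A i j) (S'.A i j)
  negB : ∀ i j, CyclicReduction.Near ρ k (S.negB i j) (S'.negB i j)
  negBhat : ∀ i j, CyclicReduction.Near ρ k (S.negBhat i j) (S'.negBhat i j)
  C : ∀ i j, CyclicReduction.Near ρ k (S.C i j) (S'.C i j)

variable {S S' S'' : Tuple n} {ρ : ℝ} {k l : ℕ}

theorem Near.trans (hρ : 1 ≤ ρ) (h : S.Near ρ k S') (h' : S'.Near ρ l S'') :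
    S.Near ρ (k + l) S'' where
  A i j := (h.A i j).trans hρ (h'.A i j)
  negB i j := (h.negB i j).trans hρ (h'.negB i j)
  negBhat i j := (h.negBhat i j).trans hρ (h'.negBhat i j)
  C i j := (h.C i j).trans hρ (h'.C i j)

theorem Regular.of_near (hρ : 1 ≤ ρ) (hS : S.Regular) (h : S'.Near ρ k S) : S'.Regular where
  A_nonneg i j := (h.A i j).nonneg hρ (hS.A_nonneg i j)
  negB_nonneg i j := (h.negB i j).nonneg hρ (hS.negB_nonneg i j)
  negBhat_nonneg i j := (h.negBhat i j).nonneg hρ (hS.negBhat_nonneg i j)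
  C_nonneg i j := (h.C i j).nonneg hρ (hS.C_nonneg i j)
  negB_diag i := by
    refine le_antisymm ?_ ((h.negB i i).nonneg hρ (hS.negB_nonneg i i))
    have := (h.negB i i).1
    rwa [hS.negB_diag, mul_zero] at this
  negBhat_diag i := by
    refine le_antisymm ?_ ((h.negBhat i i).nonneg hρ (hS.negBhat_nonneg i i))
    have := (h.negBhat i i).1
    rwa [hS.negBhat_diag, mul_zero] at this
  noFiniteTrap J hJ hne := by
    obtain ⟨l, i, hi, j, hj⟩ := hS.noFiniteTrap J hJ hne
    exact ⟨l, i, hi, j, hj.imp (And.imp_right ((h.A i j).ne_zero (hS.A_nonneg i j)))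
      (Or.imp (And.imp_right ((h.negB i j).ne_zero (hS.negB_nonneg i j)))
        (And.imp_right ((h.C i j).ne_zero (hS.C_nonneg i j))))⟩

/-- Only the `(L - 1) * n` interior rows depend on the tuple, and only these are counted. -/
theorem Regular.dirichlet_near (hρ : 1 ≤ ρ) (hS : S.Regular) (h : S'.Near ρ k S) {L : ℕ}
    {x x' : ℤ → Fin n → ℝ} (hx : ∀ l : ℤ, 0 < l → l < L → S.residual x l = 0)
    (hx' : ∀ l : ℤ, 0 < l → l < L → S'.residual x' l = 0) (h0 : x' 0 = x 0) (hL : x' L = x L)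
    (hx0 : ∀ i, 0 ≤ x 0 i) (hxL : ∀ i, 0 ≤ x L i) {l : ℕ} (hl : l ≤ L) (i : Fin n) :
    0 ≤ x l i ∧ CyclicReduction.Near ρ (2 * k * ((L - 1) * n)) (x' l i) (x l i) := by
  have hbd : ∀ p : Fin (L + 1), p ∉ Finset.Ioo 0 (Fin.last L) → (p : ℕ) = 0 ∨ (p : ℕ) = L := by
    intro p hp
    rw [Finset.mem_Ioo, Fin.lt_def, Fin.lt_def, Fin.val_zero, Fin.val_last] at hp
    have := p.isLt
    omega
  have hrhs : ∀ p, 0 ≤ levelRhs L x p := by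
    intro p
    rw [levelRhs]
    split_ifs with hp
    · rfl
    · rcases hbd _ hp with e | e <;> rw [e]
      · exact hx0 _
      · exact hxL _
  have hrhs' : levelRhs L x' = levelRhs L x := by
    ext p
    rw [levelRhs, levelRhs]
    split_ifs with hp
    · rfl
    · rcases hbd _ hp with e | e <;> rw [e]
      · exact congrFun h0 _
      · rw [hL]
  have hw : ∀ p, 0 ≤ levelRowSum (n := n) L p := fun p => by
    rw [levelRowSum]; split_ifs <;> norm_num
  have hsol := levelMatrix_isSol hx
  have hsol' := levelMatrix_isSol hx'
  have hT := hS.levelMatrix_noTrap L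
  have hz : CyclicReduction.Near ρ k 0 0 := Near.refl hρ k le_rfl
  have hN : ∀ p q, CyclicReduction.Near ρ k (S'.levelMatrix L p q) (S.levelMatrix L p q) := by
    intro p q
    rw [levelMatrix, levelMatrix]
    split_ifs
    all_goals first
      | exact hz
      | exact ((Near.add (by first | exact h.A _ _ | exact hz)
          (by first | exact h.negB _ _ | exact hz)).add (by first | exact h.C _ _ | exact hz))
  have hlt : l < L + 1 := by omega
  have hN0 := fun p q (_ : p ≠ q) => hS.levelMatrix_nonneg L p q
  refine ⟨hT.nonneg hN0 hw hrhs hsol (⟨l, hlt⟩, i), ?_⟩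
  rw [hrhs'] at hsol'
  have key := hsol.near hρ hT hN0 hw hrhs
    (Finset.Ioo (0 : Fin (L + 1)) (Fin.last L) ×ˢ (Finset.univ : Finset (Fin n)))
    (fun p hp => ?_) (fun p q _ => hN p q) (fun p => Near.refl hρ k (hw p))
    (fun p => Near.refl hρ k (hrhs p)) hsol' (⟨l, hlt⟩, i)
  · rw [Finset.card_product, Fin.card_Ioo, Finset.card_univ, Fintype.card_fin] at key
    exact key
  · have hp' : p.1 ∉ Finset.Ioo 0 (Fin.last L) := fun e =>
      hp (Finset.mem_product.2 ⟨e, Finset.mem_univ _⟩)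
    refine ⟨?_, rfl, rfl⟩
    ext q
    simp only [levelMatrix, if_neg hp']

/-- The first `k` comes from the entries of `C` or `A` that multiply the Dirichlet solution, the
rest from the solution itself on `2 ^ m - 1` interior levels. -/
theorem Regular.iterate_cr_near (hρ : 1 ≤ ρ) (hS : S.Regular) (h : S'.Near ρ k S) (m : ℕ) :
    (Tuple.cr^[m] S').Near ρ (k + 2 * k * ((2 ^ m - 1) * n)) (Tuple.cr^[m] S) := by
  have hS' := hS.of_near hρ h
  have key : ∀ a c : Fin n → ℝ, (∀ i, 0 ≤ a i) → (∀ i, 0 ≤ c i) → ∀ i,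
      CyclicReduction.Near ρ (k + 2 * k * ((2 ^ m - 1) * n))
        ((rightIncr m S' *ᵥ a + (Tuple.cr^[m] S').C *ᵥ c) i)
        ((rightIncr m S *ᵥ a + (Tuple.cr^[m] S).C *ᵥ c) i) ∧
      CyclicReduction.Near ρ (k + 2 * k * ((2 ^ m - 1) * n))
        (((Tuple.cr^[m] S').A *ᵥ a + leftIncr m S' *ᵥ c) i)
        (((Tuple.cr^[m] S).A *ᵥ a + leftIncr m S *ᵥ c) i) := by
    intro a c ha hc i
    obtain ⟨x, h0, h1, hres, hC, hA⟩ := hS.exists_dirichlet m a c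
    obtain ⟨x', h0', h1', hres', hC', hA'⟩ := hS'.exists_dirichlet m a c
    have hcast : ((2 ^ m : ℕ) : ℤ) = 2 ^ m := by push_cast; rfl
    have hpos : 1 ≤ 2 ^ m := Nat.one_le_two_pow
    have hnear := fun (l : ℕ) (hl : l ≤ 2 ^ m) (j : Fin n) =>
      hS.dirichlet_near hρ h (L := 2 ^ m) (x := x) (x' := x')
        (by rw [hcast]; exact hres) (by rw [hcast]; exact hres') (by rw [h0, h0'])
        (by rw [hcast, h1, h1']) (by rw [h0]; exact ha) (by rw [hcast, h1]; exact hc) hl j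
    rw [← hC, ← hA, ← hC', ← hA']
    constructor
    · rw [mulVec_eq, mulVec_eq]
      refine Near.sum fun j _ => ?_
      have := hnear 1 hpos j
      rw [Nat.cast_one] at this
      exact (h.C i j).mul hρ (hS.C_nonneg i j) this.1 this.2
    · rw [mulVec_eq, mulVec_eq]
      refine Near.sum fun j _ => ?_
      have := hnear (2 ^ m - 1) (by omega) j
      rw [Nat.cast_sub hpos, hcast, Nat.cast_one] at this
      exact (h.A i j).mul hρ (hS.A_nonneg i j) this.1 this.2
  have hs : ∀ q i : Fin n, 0 ≤ (Pi.single q 1 : Fin n → ℝ) i := fun q i => by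
    by_cases e : i = q <;> simp [e]
  have key1 := fun i q => key (Pi.single q 1) 0 (hs q) (fun _ => le_rfl) i
  have key2 := fun i q => key 0 (Pi.single q 1) (fun _ => le_rfl) (hs q) i
  simp only [mulVec_zero, add_zero, zero_add, mulVec_single_one, col_apply] at key1 key2
  have base : ∀ {a b : ℝ}, 0 ≤ b → CyclicReduction.Near ρ k a b →
      CyclicReduction.Near ρ (k + 2 * k * ((2 ^ m - 1) * n)) a b := fun hb hab =>
    hab.mono hρ (hab.nonneg hρ hb) hb (by omega)
  have hR := hS.iterate_cr m
  have hR' := hS'.iterate_cr m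
  refine ⟨fun i j => (key1 i j).2, fun i j => ?_, fun i j => ?_, fun i j => (key2 i j).1⟩
  · by_cases e : i = j
    · subst e
      rw [hR.negB_diag, hR'.negB_diag]
      exact Near.refl hρ _ le_rfl
    · rw [iterate_cr_negB m e, iterate_cr_negB m e]
      exact ((base (hS.negB_nonneg i j) (h.negB i j)).add (key2 i j).2).add (key1 i j).1
  · by_cases e : i = j
    · subst e
      rw [hR.negBhat_diag, hR'.negBhat_diag]
      exact Near.refl hρ _ le_rfl
    · rw [iterate_cr_negBhat m e, iterate_cr_negBhat m e]
      exact (base (hS.negBhat_nonneg i j) (h.negBhat i j)).add (key1 i j).1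

end Tuple

variable {n : ℕ}

/-! ### One floating-point step -/

/-- Exponent of the growth factor in the error bound of one step of Cyclic Reduction. -/
def stepExp (n : ℕ) : ℕ := gthExp n + 2 * n * n + n + 2

namespace FloatArith

variable {u : ℝ} (F : FloatArith u)

/-- The entries of the tuple are machine numbers. -/
structure IsMachine (S : Tuple n) : Prop where
  A : ∀ i j, S.A i j ∈ F.carrier
  negB : ∀ i j, i ≠ j → S.negB i j ∈ F.carrier
  negBhat : ∀ i j, i ≠ j → S.negBhat i j ∈ F.carrier
  C : ∀ i j, S.C i j ∈ F.carrier

variable {F} {S : Tuple n} (hu : 0 ≤ u) (hu1 : u < 1) (hS : S.Regular) (hF : F.IsMachine S)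

include hF in
theorem IsMachine.rowSums_mem (i : Fin n) : F.rowSums S.A S.C i ∈ F.carrier := by
  cases n with
  | zero => exact i.elim0
  | succ n => exact F.sum_mem _ fun j => F.add_mem _ (hF.A _ _) _ (hF.C _ _)

include hu hu1 hS hF

theorem rowSums_near (i : Fin n) : Near (growth u) n (F.rowSums S.A S.C i) (S.rowSum i) := by
  have hρ := one_le_growth hu hu1
  cases n with
  | zero => exact i.elim0
  | succ n =>
    have := F.sum_near hu hu1 (fun j => F.add (S.A i j) (S.C i j)) (fun j => S.A i j + S.C i j)
      (fun j => F.add_mem _ (hF.A _ _) _ (hF.C _ _))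
      (fun j => add_nonneg (hS.A_nonneg i j) (hS.C_nonneg i j))
      (fun j => F.add_near hu hu1 (hF.A i j) (hF.C i j) (hS.A_nonneg i j) (hS.C_nonneg i j)
        (Near.refl hρ 0 (hS.A_nonneg i j)) (Near.refl hρ 0 (hS.C_nonneg i j)))
    rw [zero_add, add_comm] at this
    exact this

/-- The computed row sums carry `n` roundings in each of `n` rows, which costs `2 * n * n` by
`IsSol.near`; GTH on the system with these row sums adds `gthExp n`. -/
theorem solve_near {M : Matrix (Fin n) (Fin n) ℝ} (hM : ∀ i j, 0 ≤ M i j)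
    (hMF : ∀ i j, M i j ∈ F.carrier) (i j : Fin n) :
    F.solve S M i j ∈ F.carrier ∧
      Near (growth u) (gthExp n + 2 * n * n) (F.solve S M i j) ((S.B⁻¹ * M) i j) := by
  have hρ := one_le_growth hu hu1
  have hN := fun i j (_ : i ≠ j) => hS.negB_nonneg i j
  have hwn := rowSums_near hu hu1 hS hF
  have hw := fun i => (hwn i).nonneg hρ (hS.rowSum_nonneg i)
  have hT : NoTrap S.negB (F.rowSums S.A S.C) :=
    hS.noTrap.of_ne_zero (fun _ _ _ h => h) fun i => (hwn i).ne_zero (hS.rowSum_nonneg i)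
  obtain ⟨y, hy⟩ := hT.exists_isSol hN hw fun l => M l j
  obtain ⟨h1, h2⟩ := F.gthSolve_near hu hu1 hF.negB hF.rowSums_mem (fun l => hMF l j) hN hw
    (fun l => hM l j) hT hy i
  refine ⟨h1, h2.trans hρ ?_⟩
  have := (hS.isSol_inv_mul M j).near hρ hS.noTrap hN hS.rowSum_nonneg (fun l => hM l j)
    Finset.univ (fun i hi => absurd (Finset.mem_univ i) hi)
    (fun i j h => Near.refl hρ n (hN i j h)) hwn (fun l => Near.refl hρ n (hM l j)) hy i
  rwa [Finset.card_univ, Fintype.card_fin] at this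

theorem isMachine_step : F.IsMachine (F.step S) := by
  have hA := fun i j => (solve_near hu hu1 hS hF hS.A_nonneg hF.A i j).1
  have hC := fun i j => (solve_near hu hu1 hS hF hS.C_nonneg hF.C i j).1
  refine ⟨F.matMul_mem hF.A hA, fun i j h => ?_, fun i j h => ?_, F.matMul_mem hF.C hC⟩
  · simp only [step, if_neg h]
    exact F.add_mem _ (F.add_mem _ (hF.negB i j h) _ (F.matMul_mem hF.A hC i j)) _
      (F.matMul_mem hF.C hA i j)
  · simp only [step, if_neg h]
    exact F.add_mem _ (hF.negBhat i j h) _ (F.matMul_mem hF.C hA i j)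

theorem step_near : (F.step S).Near (growth u) (stepExp n) S.cr := by
  have hρ := one_le_growth hu hu1
  have prod : ∀ {M M' : Matrix (Fin n) (Fin n) ℝ}, (∀ i j, 0 ≤ M i j) →
      (∀ i j, M i j ∈ F.carrier) → (∀ i j, 0 ≤ M' i j) → (∀ i j, M' i j ∈ F.carrier) → ∀ i j,
      F.matMul M (F.solve S M') i j ∈ F.carrier ∧ 0 ≤ (M * (S.B⁻¹ * M')) i j ∧
      Near (growth u) (gthExp n + 2 * n * n + n) (F.matMul M (F.solve S M') i j)
        ((M * (S.B⁻¹ * M')) i j) := by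
    intro M M' h h1 h' h1' i j
    have hs := solve_near hu hu1 hS hF h' h1'
    have hX := hS.inv_mul_nonneg h'
    have := F.matMul_near hu hu1 h1 (fun i j => (hs i j).1) h hX
      (fun i j => Near.refl hρ 0 (h i j)) (fun i j => (hs i j).2) i j
    rw [zero_add] at this
    exact ⟨F.matMul_mem h1 (fun i j => (hs i j).1) i j, Tuple.mul_entry_nonneg h hX i j, this⟩
  have weaken : ∀ {a b : ℝ} {k : ℕ}, 0 ≤ b → k ≤ stepExp n → Near (growth u) k a b →
      Near (growth u) (stepExp n) a b := fun hb hk h => h.mono hρ (h.nonneg hρ hb) hb hk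
  have hAX := prod hS.A_nonneg hF.A hS.A_nonneg hF.A
  have hAY := prod hS.A_nonneg hF.A hS.C_nonneg hF.C
  have hCX := prod hS.C_nonneg hF.C hS.A_nonneg hF.A
  have hCY := prod hS.C_nonneg hF.C hS.C_nonneg hF.C
  refine ⟨fun i j => ?_, fun i j => ?_, fun i j => ?_, fun i j => ?_⟩
  · exact weaken (hAX i j).2.1 (by rw [stepExp]; omega) (hAX i j).2.2
  · by_cases h : i = j
    · simp only [step, Tuple.cr, if_pos h]
      exact Near.refl hρ _ le_rfl
    · simp only [step, Tuple.cr, if_neg h]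
      have h1 := F.add_near hu hu1 (hF.negB i j h) (hAY i j).1 (hS.negB_nonneg i j)
        (hAY i j).2.1 (Near.refl hρ _ (hS.negB_nonneg i j)) (hAY i j).2.2
      have h2 := (hCX i j).2.2
      exact F.add_near hu hu1 (F.add_mem _ (hF.negB i j h) _ (hAY i j).1) (hCX i j).1
        (add_nonneg (hS.negB_nonneg i j) (hAY i j).2.1) (hCX i j).2.1 h1
        (h2.mono hρ (h2.nonneg hρ (hCX i j).2.1) (hCX i j).2.1 (Nat.le_succ _))
  · by_cases h : i = j
    · simp only [step, Tuple.cr, if_pos h]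
      exact Near.refl hρ _ le_rfl
    · simp only [step, Tuple.cr, if_neg h]
      refine weaken (add_nonneg (hS.negBhat_nonneg i j) (hCX i j).2.1) ?_
        (F.add_near hu hu1 (hF.negBhat i j h) (hCX i j).1 (hS.negBhat_nonneg i j)
          (hCX i j).2.1 (Near.refl hρ _ (hS.negBhat_nonneg i j)) (hCX i j).2.2)
      rw [stepExp]
      omega
  · exact weaken (hCY i j).2.1 (by rw [stepExp]; omega) (hCY i j).2.2

/-- The first step is split off: its local error perturbs the starting tuple of the remaining `k`
exact steps, while the induction hypothesis compares floating-point and exact steps from the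
computed tuple. -/
theorem iterate_step_near (hn : 1 ≤ n) (k : ℕ) :
    (F.step^[k] S).Near (growth u) (2 * n * stepExp n * (2 ^ k - 1)) (Tuple.cr^[k] S) := by
  have hρ := one_le_growth hu hu1
  induction k generalizing S with
  | zero =>
    exact ⟨fun i j => Near.refl hρ _ (hS.A_nonneg i j),
      fun i j => Near.refl hρ _ (hS.negB_nonneg i j),
      fun i j => Near.refl hρ _ (hS.negBhat_nonneg i j),
      fun i j => Near.refl hρ _ (hS.C_nonneg i j)⟩
  | succ k ih =>
    have hstep := step_near hu hu1 hS hF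
    have h1 := ih (hS.cr.of_near hρ hstep) (isMachine_step hu hu1 hS hF)
    have h2 := hS.cr.iterate_cr_near hρ hstep k
    have h3 := h1.trans hρ h2
    have hR := hS.iterate_cr (k + 1)
    -- With `m = 2 ^ k - 1` the two sides differ by `(2 * n - 1) * stepExp n`, which is nonnegative
    -- since `n ≥ 1`.
    have hle : 2 * n * stepExp n * (2 ^ k - 1) + (stepExp n + 2 * stepExp n * ((2 ^ k - 1) * n)) ≤
        2 * n * stepExp n * (2 ^ (k + 1) - 1) := by
      obtain ⟨m, hm⟩ : ∃ m, 2 ^ k = m + 1 := Nat.exists_eq_add_one.2 (by positivity)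
      have e : 2 ^ (k + 1) - 1 = 2 * m + 1 := by rw [pow_succ]; omega
      rw [hm, e, Nat.add_sub_cancel]
      nlinarith [Nat.mul_le_mul_right (stepExp n) hn]
    rw [← Function.iterate_succ_apply, ← Function.iterate_succ_apply] at h3
    have up : ∀ {a b : ℝ}, 0 ≤ b → Near (growth u) _ a b → Near (growth u) _ a b := fun hb h =>
      h.mono hρ (h.nonneg hρ hb) hb hle
    exact ⟨fun i j => up (hR.A_nonneg i j) (h3.A i j),
      fun i j => up (hR.negB_nonneg i j) (h3.negB i j),
      fun i j => up (hR.negBhat_nonneg i j) (h3.negBhat i j),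
      fun i j => up (hR.C_nonneg i j) (h3.C i j)⟩

end FloatArith

/-! ### The initial tuple -/

section Initial

variable {A B C : Matrix (Fin n) (Fin n) ℝ}

/-- The 4-tuple from which Cyclic Reduction starts. -/
def initialTuple (A B C : Matrix (Fin n) (Fin n) ℝ) : Tuple n :=
  ⟨A, negOffdiag B, negOffdiag B, C⟩

theorem HasWalk.exists_exit {ι : Type*} {M : Matrix ι ι ℝ} {J : Set ι} {m : ℕ} {p q : ι}
    (h : HasWalk M m p q) (hp : p ∈ J) (hq : q ∉ J) : ∃ a ∈ J, ∃ b, b ∉ J ∧ M a b ≠ 0 := by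
  induction m generalizing p with
  | zero => exact absurd (show p = q from h ▸ rfl) fun e => hq (e ▸ hp)
  | succ m ih =>
    obtain ⟨l, hl, h⟩ := h
    by_cases hlJ : l ∈ J
    · exact ih h hlJ
    · exact ⟨p, hp, l, hlJ, hl⟩

theorem Admissible.initialTuple_regular (h : Admissible A B C) :
    (initialTuple A B C).Regular := by
  have hB : ∀ i j, 0 ≤ negOffdiag B i j := by
    intro i j
    obtain ⟨s, P, -, hP, -, e⟩ := h.B_mMatrix
    rw [negOffdiag]
    split_ifs with hij
    · rfl
    · rw [e, Matrix.sub_apply, Matrix.smul_apply, one_apply_ne hij, smul_zero, zero_sub, neg_neg]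
      exact hP i j
  refine ⟨h.A_nonneg, hB, hB, h.C_nonneg, fun i => if_pos rfl, fun i => if_pos rfl, ?_⟩
  rintro J hJ ⟨p, hp⟩
  have : Nonempty (Fin n) := ⟨p.2⟩
  -- The index set `ℤ × Fin n` is infinite, so some node lies outside `J`, and a walk to it must
  -- leave `J`.
  obtain ⟨q, hq⟩ := hJ.exists_notMem
  obtain ⟨m, hm⟩ := h.irreducible p q
  obtain ⟨⟨l, i⟩, ha, ⟨l', j⟩, hb, hne⟩ := hm.exists_exit hp hq
  refine ⟨l, i, ha, j, ?_⟩
  simp only [biInfinite] at hne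
  split_ifs at hne with h1 h2 h3
  · subst h1
    exact Or.inl ⟨hb, hne⟩
  · subst h2
    -- A diagonal entry of `B` is a loop and cannot leave `J`, so nothing is lost by storing only
    -- the off-diagonal part.
    have hij : i ≠ j := by
      rintro rfl
      exact hb ha
    refine Or.inr (Or.inl ⟨hb, ?_⟩)
    simp only [initialTuple, negOffdiag, if_neg hij]
    exact hne
  · subst h3
    exact Or.inr (Or.inr ⟨hb, hne⟩)
  · exact absurd rfl hne

theorem Admissible.initialTuple_B (h : Admissible A B C) : (initialTuple A B C).B = B := by
  refine Tuple.eq_of_offdiag_of_mulVec_one (fun i j hij => ?_) ?_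
  · rw [Tuple.B_apply_ne _ hij]
    simp [initialTuple, negOffdiag, hij]
  · rw [Tuple.B_mulVec_one]
    have := h.mulVec_one
    rw [add_mulVec, sub_mulVec] at this
    simp only [initialTuple]
    rw [← sub_eq_zero, ← this]
    abel

/-- `Tuple.cr` uses the diagonal recovered from row sums, so its agreement with the true `B` is
carried along as part of the invariant. -/
theorem Iterate.step_tuple {T : Iterate n} (hT : T.tuple.Regular) (hB : T.tuple.B = T.B) :
    T.step.tuple = T.tuple.cr ∧ T.tuple.cr.B = T.step.B := by
  constructor
  · simp only [Tuple.cr, hB]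
    simp only [Iterate.tuple, Iterate.step, Matrix.mul_assoc]
    congr 1
    · ext i j
      simp only [negOffdiag, Matrix.sub_apply]
      split_ifs
      · rfl
      · ring
    · ext i j
      simp only [negOffdiag, Matrix.sub_apply]
      split_ifs
      · rfl
      · ring
  · rw [hT.cr_B, hB]
    simp only [Iterate.tuple, Iterate.step, Matrix.mul_assoc]

theorem Admissible.exactIterate_tuple (h : Admissible A B C) (k : ℕ) :
    (exactIterate A B C k).tuple = Tuple.cr^[k] (initialTuple A B C) ∧
      (Tuple.cr^[k] (initialTuple A B C)).B = (exactIterate A B C k).B := by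
  induction k with
  | zero => exact ⟨rfl, h.initialTuple_B⟩
  | succ k ih =>
    have hR := h.initialTuple_regular.iterate_cr k
    rw [Function.iterate_succ_apply', exactIterate]
    obtain ⟨ih1, ih2⟩ := ih
    rw [← ih1] at ih2 hR ⊢
    exact Iterate.step_tuple hR ih2

theorem FloatArith.iterate_eq {u : ℝ} (F : FloatArith u) (k : ℕ) :
    F.iterate A B C k = F.step^[k] (initialTuple A B C) := by
  induction k with
  | zero => rfl
  | succ k ih => rw [Function.iterate_succ_apply', ← ih, FloatArith.iterate]

end Initial

/-! ### The error constant -/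

theorem gthExp_eq (n : ℕ) : (gthExp n : ℝ) = (2 * n ^ 3 + 9 * n ^ 2 - 5 * n) / 3 := by
  induction n with
  | zero => simp [gthExp]
  | succ n ih =>
    rw [gthExp]
    push_cast
    rw [ih]
    ring

/-- The cubic and quadratic terms of both sides coincide; the right-hand side exceeds the left by
`27 * n + 18`. The strictness leaves room for higher-order terms in `u`. -/
theorem two_mul_stepExp_lt (n : ℕ) : 2 * (stepExp n : ℝ) < psi n + n + 2 := by
  rw [stepExp, psi]
  push_cast
  rw [gthExp_eq]
  have : (0 : ℝ) ≤ n := n.cast_nonneg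
  nlinarith

/-- Bernoulli's inequality gives `(1 - u) ^ K ≥ 1 - K * u`, and `hu'` is what makes `(1 + κ * u) *
(1 - K * u) ≥ 1`. -/
theorem Near.abs_sub_le {u a b κ : ℝ} {K : ℕ} (hu : 0 ≤ u) (hu1 : u < 1) (hκ : K ≤ κ)
    (hu' : K * κ * u ≤ κ - K) (hb : 0 ≤ b) (h : Near (growth u) K a b) :
    |a - b| ≤ κ * u * b := by
  have h1 : 0 < (1 - u) ^ K := pow_pos (by linarith) K
  have hbern : 1 - K * u ≤ (1 - u) ^ K := by
    have := one_add_mul_le_pow (a := -u) (by linarith) K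
    rw [← sub_eq_add_neg] at this
    linarith
  have hK : (0 : ℝ) ≤ K := K.cast_nonneg
  have hκ0 : 0 ≤ κ := hK.trans hκ
  have ha : 0 ≤ a := h.nonneg (one_le_growth hu hu1) hb
  obtain ⟨hab, hba⟩ := h
  rw [growth, inv_pow, inv_mul_eq_div, le_div_iff₀ h1] at hab hba
  have hκu : 0 ≤ κ * u := mul_nonneg hκ0 hu
  rw [abs_le]
  constructor
  · have : K * u * b ≤ κ * u * b := by gcongr
    nlinarith [mul_le_mul_of_nonneg_left hbern hb]
  · have key : 1 ≤ (1 + κ * u) * (1 - u) ^ K := by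
      have e : (1 + κ * u) * (1 - K * u) ≤ (1 + κ * u) * (1 - u) ^ K :=
        mul_le_mul_of_nonneg_left hbern (by linarith)
      nlinarith [mul_le_mul_of_nonneg_left hu' hu]
    have : a ≤ (1 + κ * u) * b := by
      calc a ≤ a * ((1 + κ * u) * (1 - u) ^ K) := le_mul_of_one_le_right ha key
        _ = (1 + κ * u) * (a * (1 - u) ^ K) := by ring
        _ ≤ (1 + κ * u) * b := mul_le_mul_of_nonneg_left hab (by linarith)
    linarith

end CyclicReduction

theorem mainTheorem1 (n k : ℕ) :
    ∃ u₀ : ℝ, 0 < u₀ ∧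
      ∀ (u : ℝ), 0 ≤ u → u ≤ u₀ →
      ∀ (F : CyclicReduction.FloatArith u) (A B C : Matrix (Fin n) (Fin n) ℝ),
        CyclicReduction.Admissible A B C →
        (∀ i j, A i j ∈ F.carrier) →
        (∀ i j, i ≠ j → B i j ∈ F.carrier) →
        (∀ i j, C i j ∈ F.carrier) →
        (∀ h : ℕ, IsUnit (CyclicReduction.exactIterate A B C h).B.det) ∧
        CyclicReduction.RelErrorLE (F.iterate A B C k)
          (CyclicReduction.exactIterate A B C k).tuple
          ((n : ℝ) * 2 ^ k * (CyclicReduction.psi n + n + 2) * u) := by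
  open CyclicReduction in
  -- For `n = 0` the constant `κ` vanishes and leaves no gap above `K`, but there are no entries to
  -- compare.
  rcases Nat.eq_zero_or_pos n with rfl | hn
  · exact ⟨1, one_pos, fun u _ _ F A B C _ _ _ _ => ⟨fun h => by simp,
      fun i => i.elim0, fun i => i.elim0, fun i => i.elim0, fun i => i.elim0⟩⟩
  set K : ℕ := 2 * n * stepExp n * (2 ^ k - 1) with hK
  set κ : ℝ := (n : ℝ) * 2 ^ k * (psi n + n + 2) with hκ
  have hn' : (0 : ℝ) < n := Nat.cast_pos.2 hn
  have hKκ : (K : ℝ) < κ := by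
    have h1 : (1 : ℕ) ≤ 2 ^ k := Nat.one_le_two_pow
    have h2 : (0 : ℝ) < n * 2 ^ k := by positivity
    rw [hK, hκ]
    push_cast [Nat.cast_sub h1]
    have h3 := mul_lt_mul_of_pos_left (two_mul_stepExp_lt n) h2
    have h4 : (0 : ℝ) ≤ n * stepExp n := by positivity
    linarith
  have hK0 : (0 : ℝ) ≤ K := K.cast_nonneg
  have hden : 0 < K * κ + 1 := by nlinarith [mul_nonneg hK0 (hK0.trans hKκ.le)]
  -- The second bound yields `hu2`; the `+ 1` keeps the denominator positive when `k = 0`, where `K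
  -- = 0`.
  refine ⟨min (1 / 2) ((κ - K) / (K * κ + 1)), lt_min (by norm_num)
    (div_pos (sub_pos.2 hKκ) hden), fun u hu hu₀ F A B C hABC hA hB hC => ?_⟩
  have hu1 : u < 1 := (hu₀.trans (min_le_left _ _)).trans_lt (by norm_num)
  have hu2 : K * κ * u ≤ κ - K := by
    have := (le_div_iff₀ hden).1 (hu₀.trans (min_le_right _ _))
    linarith
  have hR := hABC.initialTuple_regular
  constructor
  · intro h
    rw [← (hABC.exactIterate_tuple h).2]
    exact (hR.iterate_cr h).isUnit_det_B
  have hBF : ∀ i j, i ≠ j → negOffdiag B i j ∈ F.carrier := fun i j hij => by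
    rw [negOffdiag, if_neg hij]
    exact F.neg_mem _ (hB i j hij)
  have hF : F.IsMachine (initialTuple A B C) := ⟨hA, hBF, hBF, hC⟩
  have hnear := FloatArith.iterate_step_near hu hu1 hR hF hn k
  have hRk := hR.iterate_cr k
  rw [F.iterate_eq, (hABC.exactIterate_tuple k).1]
  exact ⟨fun i j => (hnear.A i j).abs_sub_le hu hu1 hKκ.le hu2 (hRk.A_nonneg i j),
    fun i j => (hnear.negB i j).abs_sub_le hu hu1 hKκ.le hu2 (hRk.negB_nonneg i j),
    fun i j => (hnear.negBhat i j).abs_sub_le hu hu1 hKκ.le hu2 (hRk.negBhat_nonneg i j),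
    fun i j => (hnear.C i j).abs_sub_le hu hu1 hKκ.le hu2 (hRk.C_nonneg i j)⟩
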